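/- **Setting.** Let $V$ be a vertex algebra over $\mathbb C$ with vacuum $\mathbf 1$ and fields $Y(v,x)=\sum_{j\in\mathbb Z}v_jx^{-j-1}$, put $\mathcal D v=v_{-2}\mathbf 1$, and let $g$ be an automorphism of $V$ of finite order $T$. Put $\omega_T=e^{-2\pi\sqrt{-1}/T}$ and $V^r=\{v\in V\mid gv=\omega_T^{\,r}v\}$ for $0\le r<T$, so that $V=\bigoplus_{r=0}^{T-1}V^r$. A *$g$-twisted $\phi$-coordinated $V$-module* is a complex vector space $W$ with a linear map $Y_W(\cdot,x):V\to\operatorname{Hom}(W,W((x^{1/T})))$, $Y_W(v,x)=\sum_{j\in(1/T)\mathbb Z}v_jx^{-j-1}$, such that 1. $Y_W(\mathbf 1,x)=\mathrm{id}_W$; 2. $Y_W(gv,x)=\lim_{x^{1/T}\to\omega_T^{-1}x^{1/T}}Y_W(v,x)$ for all $v\in V$; 3. for all $u,v\in V$ there is $k\in\mathbb N$ with $(x_1-x_2)^kY_W(u,x_1)Y_W(v,x_2)\in\operatorname{Hom}(W,W((x_1^{1/T},x_2^{1/T})))$ and $$x_2^k(e^{x_0}-1)^kY_W(Y(u,x_0)v,x_2)=\left.\left((x_1-x_2)^kY_W(u,x_1)Y_W(v,x_2)\right)\right|_{x_1^{1/T}=(x_2e^{x_0})^{1/T}}.$$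 Homomorphisms of such modules are the linear maps commuting with all $v_j$, $v\in V$, $j\in(1/T)\mathbb Z$. For $i\in(1/T)\mathbb Z$ write $o_i(v)=v_{-i-1}\in\operatorname{End}(W)$ and $o(v)=o_0(v)=v_{-1}$. For $n\in(1/T)\mathbb N$ put $$\tilde\Omega_n(W)=\{w\in W\mid o_m(v)w=0\text{ for all }v\in V,\ m\in(1/T)\mathbb Z,\ m<-n\}.$$ Write $n=\lfloor n\rfloor+\bar n/T$ with $\bar n\in\{0,\dots,T-1\}$, and let $\delta_{\bar n}(l)=1$ if $l\le\bar n$ and $\delta_{\bar n}(l)=0$ otherwise. For $u\in V^r$ and $v\in V$ put $$u\diamond_{g,n}v=\operatorname{Res}_x\frac{e^{x(\delta_{\bar n}(r)+\lfloor n\rfloor+r/T)}}{(e^x-1)^{2\lfloor n\rfloor+\delta_{\bar n}(r)+\delta_{\bar n}(T-r)+1}}Y(u,x)v,$$ let $u\bullet_{g,n}v=0$ if $r\ne0$, and, if $r=0$, $$u\bullet_{g,n}v=\sum_{i=0}^{\lfloor n\rfloor}(-1)^i\binom{\lfloor n\rfloor+i}{i}\operatorname{Res}_x\frac{e^{x(\lfloor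 n\rfloor+1)}}{(e^x-1)^{\lfloor n\rfloor+i+1}}Y(u,x)v;$$ extend both bilinearly to $V\times V$. Let $\tilde O_{g,n}(V)=\operatorname{span}\{u\diamond_{g,n}v\mid u,v\in V\}+\mathcal D V$ and $\tilde A_{g,n}(V)=V/\tilde O_{g,n}(V)$. **Theorem 4.4.** Let $V$, $g$, $T$ be as above and $n\in(1/T)\mathbb N$. The product $\bullet_{g,n}$ induces on $\tilde A_{g,n}(V)$ the structure of an associative $\mathbb C$-algebra with identity $\mathbf 1+\tilde O_{g,n}(V)$. For every $g$-twisted $\phi$-coordinated $V$-module $W$, the space $\tilde\Omega_n(W)$ is an $\tilde A_{g,n}(V)$-module, on which the class of $v\in V$ acts by $o(v)=v_{-1}$. Every homomorphism $f:W\to W'$ of $g$-twisted $\phi$-coordinated $V$-modules restricts to a homomorphism of $\tilde A_{g,n}(V)$-modules $\tilde\Omega_n(W)\to\tilde\Omega_n(W')$, and these restrictions respect identities and composition; thus $\tilde\Omega_n$ is a functor from $g$-twisted $\phi$-coordinated $V$-modules to $\tilde A_{g,n}(V)$-modules. -/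

import Mathlib

universe u w

noncomputable section

/-- A vertex algebra over `ℂ`. `Y v` is the field `Y(v, x)`, a linear map `V → V((x))`; this
encodes that `u_n v = 0` for `n` large. Its mode `v_n`, the coefficient of `x ^ (-n - 1)`, is
`VertexOperator.ncoeff (Y v) n`.

The field `jacobi` is the coefficient of `z₀ ^ (-k - 1) z₁ ^ (-m - 1) z₂ ^ (-n - 1)` of the
Jacobi identity. All sums occurring in it have finite support. -/
class VertexAlgebra (V : Type u) [AddCommGroup V] [Module ℂ V] where
  Y : V →ₗ[ℂ] VertexOperator ℂ V
  vac : V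
  vac_mode : ∀ (n : ℤ) (v : V),
    VertexOperator.ncoeff (Y vac) n v = if n = -1 then v else 0
  mode_vac : ∀ (v : V) (n : ℤ), -1 ≤ n →
    VertexOperator.ncoeff (Y v) n vac = if n = -1 then v else 0
  jacobi : ∀ (u v w : V) (k m n : ℤ),
    (∑ᶠ j : ℕ, (-1 : ℤ) ^ j • Ring.choose k j •
        VertexOperator.ncoeff (Y u) (m + k - j) (VertexOperator.ncoeff (Y v) (n + j) w))
      - (∑ᶠ j : ℕ, (Int.negOnePow (k + j) : ℤ) • Ring.choose k j •
        VertexOperator.ncoeff (Y v) (n + k - j) (VertexOperator.ncoeff (Y u) (m + j) w))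
      = ∑ᶠ j : ℕ, Ring.choose m j •
        VertexOperator.ncoeff (Y (VertexOperator.ncoeff (Y u) (k + j) v)) (m + n - j) w

namespace VertexAlgebra

section Basic

variable {V : Type u} [AddCommGroup V] [Module ℂ V] [VertexAlgebra V]

/-- The mode `v_n`, i.e. `Y(v, x) = ∑ v_n x ^ (-n - 1)`. -/
def mode (v : V) (n : ℤ) : V →ₗ[ℂ] V := VertexOperator.ncoeff (Y v) n

/-- The operator `𝒟 v = v_{-2} 𝟏`. -/
def opD (v : V) : V := mode v (-2) vac

/-- `Res_x f(x) Y(u, x) v` for a Laurent series `f`. -/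
def res (f : LaurentSeries ℂ) (u v : V) : V := ∑ᶠ j : ℤ, f.coeff j • mode u j v

end Basic

/-- Automorphisms of a vertex algebra. -/
structure Aut (V : Type u) [AddCommGroup V] [Module ℂ V] [VertexAlgebra V] where
  toLinearEquiv : V ≃ₗ[ℂ] V
  map_vac : toLinearEquiv vac = vac
  map_mode : ∀ (u v : V) (n : ℤ),
    toLinearEquiv (mode u n v) = mode (toLinearEquiv u) n (toLinearEquiv v)

/-- The Laurent series expansion of `e ^ (a x) / (e ^ x - 1) ^ k` at `x = 0`. -/
def expQuot (a : ℂ) (k : ℕ) : LaurentSeries ℂ :=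
  HahnSeries.ofPowerSeries ℤ ℂ (PowerSeries.rescale a (PowerSeries.exp ℂ)) /
    (HahnSeries.ofPowerSeries ℤ ℂ (PowerSeries.exp ℂ - 1)) ^ k

/-- `δ_k(l) = 1` if `l ≤ k` and `0` otherwise. -/
def stepDelta (k l : ℕ) : ℕ := if l ≤ k then 1 else 0

section Zhu

variable {V : Type u} [AddCommGroup V] [Module ℂ V] [VertexAlgebra V] (g : Aut V) (T : ℕ)

/-- `ω_T = e ^ (-2 π i / T)`. -/
def omegaT : ℂ := Complex.exp (-2 * Real.pi * Complex.I / T)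

/-- `V ^ r = {v | g v = e ^ (-2 π i r / T) v}`. -/
def eigen (r : ℕ) : Submodule ℂ V :=
  Module.End.eigenspace (g.toLinearEquiv : V →ₗ[ℂ] V) (omegaT T ^ r)

/-- The projection of `V` onto `V ^ 0` along the other `V ^ r`, namely `(1 / T) ∑ g ^ j` over
`0 ≤ j < T`. -/
def projZero (v : V) : V :=
  (T : ℂ)⁻¹ • ∑ j ∈ Finset.range T, (g.toLinearEquiv ^ j) v

/-! Elements of `(1/T) ℕ` are represented by their numerators: the natural number `n` below stands
for `n / T`, whose integer part is `n / T` (division in `ℕ`) and whose fractional part is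
`(n % T) / T`. -/

/-- `u ◇_{g, n} v` for `u` in `V ^ r`, `0 ≤ r < T`. -/
def diamond (n r : ℕ) (u v : V) : V :=
  res (expQuot ((stepDelta (n % T) r : ℂ) + ((n / T : ℕ) : ℂ) + (r : ℂ) / T)
    (2 * (n / T) + stepDelta (n % T) r + stepDelta (n % T) (T - r) + 1)) u v

/-- The product `u •_{g, n} v`. It vanishes for `u` in `V ^ r` with `0 < r < T`, and for `u` in
`V ^ 0` it is, with `N` the integer part of `n / T`,
`∑ i ≤ N, (-1) ^ i (N + i choose i) Res_x e ^ ((N + 1) x) / (e ^ x - 1) ^ (N + i + 1) Y(u, x) v`. -/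
def bullet (n : ℕ) (u v : V) : V :=
  ∑ i ∈ Finset.range (n / T + 1), ((-1 : ℂ) ^ i * ((n / T + i).choose i : ℂ)) •
    res (expQuot (((n / T : ℕ) : ℂ) + 1) (n / T + i + 1)) (projZero g T u) v

/-- `Õ_{g, n}(V)`: the span of all `u ◇_{g, n} v` and all `𝒟 u`. By linearity the elements `u` in
`u ◇_{g, n} v` may be taken homogeneous. -/
def zhuO (n : ℕ) : Submodule ℂ V :=
  Submodule.span ℂ ({x | ∃ r < T, ∃ u ∈ eigen g T r, ∃ v : V, x = diamond T n r u v} ∪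
    Set.range (opD : V → V))

/-- The set underlying `Ã_{g, n}(V) = V / Õ_{g, n}(V)`. It is a type of its own, so that the only
algebraic structure on it is the one that is put there explicitly. -/
def Zhu (n : ℕ) : Type u := V ⧸ zhuO g T n

/-- The class `v + Õ_{g, n}(V)`. -/
def toZhu (n : ℕ) (v : V) : Zhu g T n := (zhuO g T n).mkQ v

end Zhu

/-- A `g`-twisted `φ`-coordinated `V`-module, for `φ(x, z) = x e ^ z` and `g` of order `T`.
Everything is written in the variable `t = x ^ (1/T)`: the field `Y_W(v, x)` is a linear map
`W → W((t))`, and `HVertexOperator.coeff (YW v) a` is the coefficient of `t ^ a = x ^ (a/T)`. -/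
structure TwistedPhiModule {V : Type u} [AddCommGroup V] [Module ℂ V] [VertexAlgebra V]
    (g : Aut V) (T : ℕ) where
  carrier : Type w
  [addCommGroup : AddCommGroup carrier]
  [module : Module ℂ carrier]
  YW : V →ₗ[ℂ] HVertexOperator ℤ ℂ carrier carrier
  /-- `Y_W(𝟏, x) = id`. -/
  vac_coeff : ∀ (a : ℤ) (x : carrier),
    HVertexOperator.coeff (YW vac) a x = if a = 0 then x else 0
  /-- `Y_W(g v, x)` is obtained from `Y_W(v, x)` by the substitution `t ↦ ω_T⁻¹ t`. -/
  twist : ∀ (v : V) (a : ℤ) (x : carrier),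
    HVertexOperator.coeff (YW (g.toLinearEquiv v)) a x =
      (omegaT T)⁻¹ ^ a • HVertexOperator.coeff (YW v) a x
  /-- For all `u, v` there is `k` with the following property. Let `A a b x` be the coefficient of
  `t₁ ^ a t₂ ^ b` in `(x₁ - x₂) ^ k Y_W(u, x₁) Y_W(v, x₂) x`, where `x₁ = t₁ ^ T` and
  `x₂ = t₂ ^ T`. Then `A` is the coefficient family of an element of `W((t₁, t₂))`; and for all
  `c` and `j`, the coefficients of `t₂ ^ c x₀ ^ j` in `x₂ ^ k (e ^ x₀ - 1) ^ k Y_W(Y(u, x₀) v, x₂) x`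
  and in the series obtained from `A` by the substitution `t₁ = t₂ e ^ (x₀ / T)` agree. -/
  assoc : ∀ u v : V, ∃ k : ℕ, ∀ x : carrier, ∃ A : ℤ → ℤ → carrier,
    (∀ a b : ℤ, A a b = ∑ i ∈ Finset.range (k + 1), ((-1 : ℂ) ^ i * (k.choose i : ℂ)) •
      HVertexOperator.coeff (YW u) (a - T * ((k : ℤ) - i))
        (HVertexOperator.coeff (YW v) (b - T * (i : ℤ)) x)) ∧
    (∃ N : ℤ, ∀ a b : ℤ, (a < N ∨ b < N) → A a b = 0) ∧
    (∀ c j : ℤ,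
      (∑ᶠ i : ℕ, PowerSeries.coeff i ((PowerSeries.exp ℂ - 1) ^ k) •
        HVertexOperator.coeff (YW (mode u ((i : ℤ) - j - 1) v)) (c - T * (k : ℤ)) x) =
      if 0 ≤ j then
        ∑ᶠ a : ℤ, (((a : ℂ) / T) ^ j.toNat / (j.toNat.factorial : ℂ)) • A a (c - a)
      else 0)

attribute [instance] TwistedPhiModule.addCommGroup TwistedPhiModule.module

namespace TwistedPhiModule

variable {V : Type u} [AddCommGroup V] [Module ℂ V] [VertexAlgebra V] {g : Aut V} {T : ℕ}

/-- `o_{a/T}(v) = v_{-a/T-1}`, the coefficient of `x ^ (a/T)` in `Y_W(v, x)`. In particular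
`o M 0 v` is `o(v) = v_{-1}`. -/
def o (M : TwistedPhiModule.{u, w} g T) (a : ℤ) (v : V) : M.carrier →ₗ[ℂ] M.carrier :=
  HVertexOperator.coeff (M.YW v) a

/-- `Ω̃_{n/T}(W)`: the vectors that are killed by `o_m(v)` for all `v` and all `m < -n/T`. -/
def Omega (M : TwistedPhiModule.{u, w} g T) (n : ℕ) : Submodule ℂ M.carrier :=
  ⨅ (v : V) (a : ℤ) (_ : a < -(n : ℤ)), LinearMap.ker (M.o a v)

/-- Homomorphisms of `g`-twisted `φ`-coordinated modules. -/
structure Hom (M N : TwistedPhiModule.{u, w} g T) where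
  toLinearMap : M.carrier →ₗ[ℂ] N.carrier
  map_o : ∀ (a : ℤ) (v : V) (x : M.carrier), toLinearMap (M.o a v x) = N.o a v (toLinearMap x)

/-- The identity homomorphism. -/
def Hom.id (M : TwistedPhiModule.{u, w} g T) : Hom M M := ⟨LinearMap.id, fun _ _ _ => rfl⟩

/-- The composite of two homomorphisms. -/
def Hom.comp {M N P : TwistedPhiModule.{u, w} g T} (f' : Hom N P) (f : Hom M N) : Hom M P :=
  ⟨f'.toLinearMap ∘ₗ f.toLinearMap, fun a v x => by simp [f.map_o, f'.map_o]⟩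

end TwistedPhiModule

end VertexAlgebra

end

/-! Put `y = e ^ x`. All residues have the form `Res_x f(x) Y(u, x) v` with `f` built from `y ^ a /
(y - 1) ^ k`, so everything depends on the behaviour of such functions at `y = 0` and `y = ∞`, and
on their residue vanishing for integers `1 ≤ a < k`.

Algebra. As `Y(𝒟 u, x) = d/dx Y(u, x)` and `𝒟 V` lies in `Õ`, the series `h` that send `V ^ r` into
`Õ` form a space stable under `d/dx`. It therefore contains, besides the series of `◇`, all those
decaying at least as fast at `0` and `∞` (`diamondSeries_le`). For `0 < r < T` this puts `V ^ r`
itself into `Õ` (`eigen_le_zhuO`), so only `V ^ 0` matters. The series `B` of `•` is regular at `0`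
and `∞` and has residue 1, while `B'` and `B(-x) B(x)` decay like the `◇` series for `r = 0`. Hence
the commutator formula, with skew-symmetry modulo `𝒟 V`, makes `Õ` a two-sided ideal
(`res_regular_mem_zhuO`, `res_left_mem_zhuO`). The iterate formula gives associativity, since every
term other than `u • (v • w)` involves a derivative of `B` or `B(-x) B(x)` (`res_assoc_mem_zhuO`).

Modules. For `w` in `Ω̃_n`, the function `⟨φ, o(Y(u, z) v) w⟩` is `p(t) / (t ^ T - 1) ^ k` at `t = e
^ (z / T)`, with `p` a Laurent polynomial. Its expansion at `t = ∞` has the coefficients `⟨φ, o_a(u)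
o_{-a}(v) w⟩`, zero for `a > n` (numerators understood). Since `o(𝒟 V) = 0`, exchanging `u` and `v`
amounts to `t ↦ t⁻¹`, which bounds `p` from below by degree `-n`. Splitting off the terms with `|a|
≤ n` leaves a fraction (`correlator_decomposition`) with residue zero against the series of `◇` and
`•`. On the split-off terms `◇` gives zero and `B` selects `a = 0`. So `Õ` acts by zero and `o(u •
v) = o(u) o(v)`. -/

noncomputable section
namespace VertexAlgebra
open HahnSeries

/-! ### Calculus of formal Laurent series. -/

section LaurentCalculus

instance : IsScalarTower ℂ (LaurentSeries ℂ) (LaurentSeries ℂ) where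
  smul_assoc a f g := by
    change (a • f) * g = a • (f * g)
    rw [← C_mul_eq_smul, ← C_mul_eq_smul, mul_assoc]

instance : SMulCommClass ℂ (LaurentSeries ℂ) (LaurentSeries ℂ) where
  smul_comm a f g := by
    change a • (f * g) = f * a • g
    rw [← C_mul_eq_smul, ← C_mul_eq_smul, mul_left_comm]

/-- The coefficients of `f` in degrees less than `N` vanish. -/
def VanishesBelow (N : ℤ) (f : LaurentSeries ℂ) : Prop := ∀ m < N, f.coeff m = 0

lemma exists_vanishesBelow (f : LaurentSeries ℂ) : ∃ N, VanishesBelow N f :=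
  ⟨f.order, fun _ h => coeff_eq_zero_of_lt_order h⟩

lemma support_mul_finite (f g : LaurentSeries ℂ) (n : ℤ) :
    (Function.support fun i : ℤ => f.coeff i * g.coeff (n - i)).Finite := by
  obtain ⟨a, ha⟩ := exists_vanishesBelow f
  obtain ⟨b, hb⟩ := exists_vanishesBelow g
  refine (Set.finite_Icc a (n - b)).subset fun i hi => ?_
  by_contra h
  simp only [Set.mem_Icc, not_and_or, not_le] at h
  rcases h with h | h
  · exact hi (by simp [ha i h])
  · exact hi (by simp [hb (n - i) (by lia)])

lemma coeff_mul_finsum (f g : LaurentSeries ℂ) (n : ℤ) :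
    (f * g).coeff n = ∑ᶠ i : ℤ, f.coeff i * g.coeff (n - i) := by
  rw [coeff_mul]
  have hfin := support_mul_finite f g n
  rw [finsum_eq_sum _ hfin]
  symm
  refine Finset.sum_bij_ne_zero (fun i _ _ => (i, n - i)) ?_ ?_ ?_ ?_
  · intro i _ hne
    simp only [Finset.mem_antidiagonal, mem_support]
    exact ⟨left_ne_zero_of_mul hne, right_ne_zero_of_mul hne, by ring⟩
  · intro i _ _ j _ _ h
    exact (Prod.ext_iff.1 h).1
  · rintro ⟨i, j⟩ hij hne
    simp only [Finset.mem_antidiagonal] at hij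
    have : j = n - i := by lia
    subst this
    exact ⟨i, by simpa using hne, hne, rfl⟩
  · intros; rfl

lemma VanishesBelow.mul {N M : ℤ} {f g : LaurentSeries ℂ} (hf : VanishesBelow N f)
    (hg : VanishesBelow M g) : VanishesBelow (N + M) (f * g) := by
  intro m hm
  rw [coeff_mul_finsum]
  refine finsum_eq_zero_of_forall_eq_zero fun i => ?_
  by_cases h : i < N
  · simp [hf i h]
  · simp [hg (m - i) (by lia)]

lemma VanishesBelow.hasseDeriv {N : ℤ} {f : LaurentSeries ℂ} (hf : VanishesBelow N f) (j : ℕ) :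
    VanishesBelow (N - j) (LaurentSeries.hasseDeriv ℂ j f) := by
  intro m hm
  simp [hf (m + j) (by lia)]

/-- The derivative of a Laurent series with complex coefficients. -/
abbrev deriv : LaurentSeries ℂ →ₗ[ℂ] LaurentSeries ℂ := LaurentSeries.hasseDeriv ℂ 1

lemma coeff_deriv (f : LaurentSeries ℂ) (n : ℤ) :
    (deriv f).coeff n = (n + 1 : ℂ) * f.coeff (n + 1) := by
  simp

lemma deriv_mul (f g : LaurentSeries ℂ) : deriv (f * g) = deriv f * g + f * deriv g := by
  ext n
  -- Shifting the index in one sum aligns the summands; what remains is `n + 1 = i + (n + 1 - i)`.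
  rw [coeff_deriv, coeff_add, coeff_mul_finsum, coeff_mul_finsum, coeff_mul_finsum,
    ← finsum_comp_equiv (Equiv.addRight (-1 : ℤ)) (f := fun i => (deriv f).coeff i * _),
    ← smul_eq_mul, smul_finsum, ← finsum_add_distrib]
  · refine finsum_congr fun i => ?_
    simp only [coeff_deriv, Equiv.coe_addRight, smul_eq_mul]
    rw [show n + 1 - i = n - i + 1 by ring, show n - (i + -1) = n - i + 1 by ring,
      show i + -1 + 1 = i by ring]
    push_cast
    ring
  · exact (support_mul_finite (deriv f) g n).preimage (Equiv.injective _).injOn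
  · exact support_mul_finite f (deriv g) n

/-- Integration by parts: this yields the recursion for residues of exponential fractions and the
evaluation of `bulletSeries` on exponentials. -/
lemma coeff_deriv_neg_one (f : LaurentSeries ℂ) : (deriv f).coeff (-1) = 0 := by
  rw [coeff_deriv]; simp

lemma deriv_iterate (j : ℕ) (f : LaurentSeries ℂ) :
    deriv^[j] f = (j.factorial : ℂ) • LaurentSeries.hasseDeriv ℂ j f := by
  have := LaurentSeries.derivative_iterate (R := ℂ) j f
  rw [Nat.cast_smul_eq_nsmul, ← this]
  rfl

/-- A submodule containing the iterated derivatives of `f` contains its Hasse derivatives. -/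
lemma hasseDeriv_mem {S : Submodule ℂ (LaurentSeries ℂ)} {f : LaurentSeries ℂ} {j : ℕ}
    (h : deriv^[j] f ∈ S) : LaurentSeries.hasseDeriv ℂ j f ∈ S := by
  rw [deriv_iterate] at h
  exact (S.smul_mem_iff (by exact_mod_cast j.factorial_ne_zero)).1 h

/-- The substitution `x ↦ -x` in Laurent series. -/
def negX : LaurentSeries ℂ →+* LaurentSeries ℂ where
  toFun f := HahnSeries.ofSuppBddBelow (fun n => (-1 : ℂ) ^ n * f.coeff n) (by
    obtain ⟨N, hN⟩ := exists_vanishesBelow f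
    refine ⟨N, fun n hn => ?_⟩
    by_contra h
    exact hn (by simp [hN n (not_le.1 h)]))
  map_add' f g := by ext n; simp [HahnSeries.ofSuppBddBelow, mul_add]
  map_zero' := by ext n; simp [HahnSeries.ofSuppBddBelow]
  map_one' := by
    ext n
    simp only [HahnSeries.ofSuppBddBelow, coeff_one]
    by_cases h : n = 0 <;> simp [h]
  map_mul' f g := by
    ext n
    simp only [HahnSeries.ofSuppBddBelow, coeff_mul_finsum]
    rw [← smul_eq_mul, smul_finsum]
    refine finsum_congr fun i => ?_
    have : (-1 : ℂ) ^ n = (-1) ^ i * (-1) ^ (n - i) := by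
      rw [← zpow_add₀ (by norm_num)]; congr 1; ring
    rw [this, smul_eq_mul]
    ring

lemma coeff_negX (f : LaurentSeries ℂ) (n : ℤ) :
    (negX f).coeff n = (-1 : ℂ) ^ n * f.coeff n := rfl

lemma negX_smul (c : ℂ) (f : LaurentSeries ℂ) : negX (c • f) = c • negX f := by
  ext n
  simp only [coeff_negX, HahnSeries.coeff_smul, smul_eq_mul]
  ring

lemma VanishesBelow.negX {N : ℤ} {f : LaurentSeries ℂ} (hf : VanishesBelow N f) :
    VanishesBelow N (negX f) := by
  intro m hm
  simp [coeff_negX, hf m hm]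

lemma negX_negX (f : LaurentSeries ℂ) : negX (negX f) = f := by
  ext n
  rw [coeff_negX, coeff_negX, ← mul_assoc, ← mul_zpow]
  simp

lemma deriv_negX (f : LaurentSeries ℂ) : deriv (negX f) = -negX (deriv f) := by
  ext n
  rw [coeff_neg, coeff_deriv, coeff_negX, coeff_negX, coeff_deriv, zpow_add₀ (by norm_num)]
  simp; ring

/-- A linear map on Laurent series that kills the monomials of degree at least `N` and the series
of large order kills all series that vanish below `N`. -/
lemma eq_zero_of_monomials {U : Type*} [AddCommGroup U] [Module ℂ U]
    (L : LaurentSeries ℂ →ₗ[ℂ] U) {N M : ℤ} (hmono : ∀ m, N ≤ m → L (single m 1) = 0)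
    (htail : ∀ f, VanishesBelow M f → L f = 0) {f : LaurentSeries ℂ} (hf : VanishesBelow N f) :
    L f = 0 := by
  -- Removing the finitely many terms of degrees in `[N, M)` leaves a series to which `htail`
  -- applies.
  have key : VanishesBelow M (f - ∑ m ∈ Finset.Ico N M, f.coeff m • single m (1 : ℂ)) := by
    intro m hm
    rw [coeff_sub, HahnSeries.coeff_sum]
    simp only [HahnSeries.coeff_smul, coeff_single, smul_eq_mul, mul_ite, mul_one, mul_zero,
      Finset.sum_ite_eq, Finset.mem_Ico]
    split_ifs with h
    · simp
    · simp [hf m (by by_contra h'; exact h ⟨not_lt.1 h', hm⟩)]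
  have h1 := htail _ key
  rw [map_sub, map_sum, sub_eq_zero] at h1
  rw [h1]
  refine Finset.sum_eq_zero fun m hm => ?_
  rw [map_smul, hmono m (Finset.mem_Ico.1 hm).1, smul_zero]

end LaurentCalculus

/-! ### The fractions `e ^ (a x) / (e ^ x - 1) ^ k` and their residues. -/

section Exponentials

/-- The series `e ^ (a x)`. -/
abbrev expo (a : ℂ) : LaurentSeries ℂ :=
  HahnSeries.ofPowerSeries ℤ ℂ (PowerSeries.rescale a (PowerSeries.exp ℂ))

/-- The series `e ^ x - 1`. -/
abbrev expSubOne : LaurentSeries ℂ := HahnSeries.ofPowerSeries ℤ ℂ (PowerSeries.exp ℂ - 1)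

lemma expQuot_eq (a : ℂ) (k : ℕ) : expQuot a k = expo a / expSubOne ^ k := rfl

lemma expo_mul (a b : ℂ) : expo a * expo b = expo (a + b) := by
  rw [expo, expo, ← map_mul, PowerSeries.exp_mul_exp_eq_exp_add]

lemma expo_zero : expo 0 = 1 := by
  rw [expo, PowerSeries.rescale_zero]
  simp

lemma expSubOne_eq : expSubOne = expo 1 - 1 := by
  simp [expSubOne, expo]

lemma coeff_expo (a : ℂ) (j : ℕ) : (expo a).coeff j = a ^ j / j.factorial := by
  rw [expo, LaurentSeries.coeff_coe_powerSeries]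
  simp [PowerSeries.coeff_rescale, PowerSeries.coeff_exp, div_eq_mul_inv]

lemma coeff_ofPowerSeries_of_neg (p : PowerSeries ℂ) {n : ℤ} (hn : n < 0) :
    (HahnSeries.ofPowerSeries ℤ ℂ p).coeff n = 0 := by
  rw [ofPowerSeries_apply, embDomain_of_notMem_range]
  simp only [Set.mem_range, not_exists]
  intro m hm
  simp at hm
  lia

lemma expSubOne_ne_zero : expSubOne ≠ 0 := by
  intro h
  have := congrArg (fun f => f.coeff ((1 : ℕ) : ℤ)) (expSubOne_eq.symm.trans h)
  simp only [coeff_sub, coeff_expo, coeff_one] at this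
  norm_num at this

lemma expSubOne_pow_ne_zero (k : ℕ) : expSubOne ^ k ≠ 0 := pow_ne_zero k expSubOne_ne_zero

lemma expQuot_mul (a b : ℂ) (k l : ℕ) :
    expQuot a k * expQuot b l = expQuot (a + b) (k + l) := by
  rw [expQuot_eq, expQuot_eq, expQuot_eq, div_mul_div_comm, expo_mul, _root_.pow_add]

lemma expQuot_zero (a : ℂ) : expQuot a 0 = expo a := by rw [expQuot_eq, pow_zero, div_one]

lemma expQuot_mul_pow (a : ℂ) (k : ℕ) : expQuot a k * expSubOne ^ k = expo a :=
  div_mul_cancel₀ _ (expSubOne_pow_ne_zero k)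

lemma expQuot_sub (a : ℂ) (k : ℕ) :
    expQuot (a + 1) (k + 1) - expQuot a (k + 1) = expQuot a k := by
  rw [expQuot_eq, expQuot_eq, expQuot_eq, ← expo_mul, pow_succ, ← sub_div,
    show expo a * expo 1 - expo a = expo a * expSubOne by rw [expSubOne_eq]; ring,
    mul_div_mul_right _ _ expSubOne_ne_zero]

lemma deriv_expo (a : ℂ) : deriv (expo a) = a • expo a := by
  ext n
  rw [coeff_deriv, HahnSeries.coeff_smul]
  rcases le_or_gt 0 n with hn | hn
  · lift n to ℕ using hn
    rw [coeff_expo, show (n : ℤ) + 1 = ((n + 1 : ℕ) : ℤ) by push_cast; rfl, coeff_expo,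
      Nat.factorial_succ, smul_eq_mul]
    have : (n.factorial : ℂ) ≠ 0 := by exact_mod_cast n.factorial_ne_zero
    have : (n + 1 : ℂ) ≠ 0 := by exact_mod_cast n.succ_ne_zero
    push_cast
    field_simp
    ring
  · rw [coeff_ofPowerSeries_of_neg _ hn]
    rcases eq_or_lt_of_le (Int.add_one_le_iff.2 hn) with h | h
    · have : (n : ℂ) + 1 = 0 := by exact_mod_cast h
      simp [this]
    · rw [coeff_ofPowerSeries_of_neg _ h]; simp

lemma deriv_one : deriv 1 = 0 := by
  rw [← expo_zero, deriv_expo, ← C_mul_eq_smul, map_zero, zero_mul]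

lemma deriv_expSubOne : deriv expSubOne = expo 1 := by
  rw [expSubOne_eq, map_sub, deriv_expo, deriv_one, one_smul, sub_zero]

lemma deriv_expQuot (a : ℂ) (k : ℕ) :
    deriv (expQuot a k) = a • expQuot a k - (k : ℂ) • expQuot (a + 1) (k + 1) := by
  induction k with
  | zero => rw [expQuot_zero, deriv_expo, Nat.cast_zero, ← C_mul_eq_smul (r := 0), map_zero,
      zero_mul, sub_zero]
  | succ k ih =>
    -- The product rule applied to this identity is solved for the unknown derivative.
    have h0 : expQuot a (k + 1) * expSubOne = expQuot a k := by
      rw [expQuot_eq, expQuot_eq, pow_succ, ← div_div, div_mul_cancel₀ _ expSubOne_ne_zero]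
    have h1 := congrArg deriv h0
    rw [deriv_mul, deriv_expSubOne, ih] at h1
    apply mul_right_cancel₀ expSubOne_ne_zero
    have h2 : expQuot a (k + 1) * expo 1 = expQuot (a + 1) (k + 1) := by
      rw [← expQuot_zero, expQuot_mul]
    have h3 : expQuot (a + 1) (k + 1 + 1) * expSubOne = expQuot (a + 1) (k + 1) := by
      rw [expQuot_eq, expQuot_eq, pow_succ _ (k + 1), ← div_div,
        div_mul_cancel₀ _ expSubOne_ne_zero]
    rw [sub_mul, smul_mul_assoc, smul_mul_assoc, h0, h3, eq_sub_of_add_eq h1, h2]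
    push_cast
    module

lemma deriv_expQuot' (a : ℂ) (k : ℕ) :
    deriv (expQuot a k) = (a - k) • expQuot a k - (k : ℂ) • expQuot a (k + 1) := by
  rw [deriv_expQuot, ← expQuot_sub a k]
  module

lemma negX_expo (a : ℂ) : negX (expo a) = expo (-a) := by
  ext n
  rw [coeff_negX]
  rcases le_or_gt 0 n with hn | hn
  · lift n to ℕ using hn
    rw [coeff_expo, coeff_expo, neg_pow a, zpow_natCast]
    ring
  · rw [coeff_ofPowerSeries_of_neg _ hn, coeff_ofPowerSeries_of_neg _ hn, mul_zero]

lemma negX_expSubOne : negX expSubOne = -(expSubOne * expo (-1)) := by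
  rw [expSubOne_eq, map_sub, negX_expo, map_one, sub_mul, expo_mul]
  simp [expo_zero]

/-- Follows from `e ^ (-x) - 1 = -e ^ (-x) (e ^ x - 1)`. -/
lemma negX_expQuot (a : ℂ) (k : ℕ) : negX (expQuot a k) = (-1 : ℂ) ^ k • expQuot (k - a) k := by
  have h := congrArg negX (expQuot_mul_pow a k)
  rw [map_mul, map_pow, negX_expo, negX_expSubOne] at h
  have hp : ∀ j : ℕ, expo (-1) ^ j = expo (-j) := by
    intro j
    induction j with
    | zero => simp [expo_zero]
    | succ j ih => rw [pow_succ, ih, expo_mul]; push_cast; ring_nf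
  have hne : (-(expSubOne * expo (-1))) ^ k ≠ 0 := by
    refine pow_ne_zero _ (neg_ne_zero.2 (mul_ne_zero expSubOne_ne_zero fun h0 => ?_))
    have := expo_mul (-1) 1
    rw [h0] at this
    simp [expo_zero] at this
  apply mul_right_cancel₀ hne
  rw [h, neg_pow (expSubOne * expo (-1)), _root_.mul_pow, hp, smul_mul_assoc, mul_left_comm,
    ← mul_assoc (expQuot _ _),
    expQuot_mul_pow, expo_mul, show (k - a + -(k : ℂ)) = -a by ring]
  have : ((-1 : LaurentSeries ℂ)) ^ k = (-1 : ℂ) ^ k • 1 := by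
    rw [← C_mul_eq_smul, mul_one, map_pow, map_neg, map_one]
  rw [this, smul_mul_assoc, one_mul, smul_smul, ← _root_.mul_pow]
  simp

/-- The residue of a Laurent series. -/
abbrev residue (f : LaurentSeries ℂ) : ℂ := f.coeff (-1)

/-- Here `e ^ x - 1 = x p(x)` with `p(0) = 1`, so the pole is simple and `a` does not affect the
residue. -/
lemma residue_expQuot_one (a : ℂ) : residue (expQuot a 1) = 1 := by
  obtain ⟨p, hp⟩ : (PowerSeries.X : PowerSeries ℂ) ∣ PowerSeries.exp ℂ - 1 := by
    rw [PowerSeries.X_dvd_iff]; simp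
  have hc : PowerSeries.constantCoeff p = 1 := by
    have := congrArg (PowerSeries.coeff 1) hp
    rw [show 1 = 0 + 1 from rfl, PowerSeries.coeff_succ_X_mul] at this
    simpa [PowerSeries.coeff_exp, PowerSeries.coeff_one] using this.symm
  have hpi : p * p⁻¹ = 1 := PowerSeries.mul_inv_cancel _ (by simp [hc])
  have : expQuot a 1 = single (-1) 1 *
      HahnSeries.ofPowerSeries ℤ ℂ (PowerSeries.rescale a (PowerSeries.exp ℂ) * p⁻¹) := by
    apply mul_right_cancel₀ expSubOne_ne_zero
    have h1 := expQuot_mul_pow a 1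
    rw [pow_one] at h1
    rw [h1, expSubOne, hp, mul_assoc, ← map_mul,
      show PowerSeries.rescale a (PowerSeries.exp ℂ) * p⁻¹ * (PowerSeries.X * p) =
        PowerSeries.X * PowerSeries.rescale a (PowerSeries.exp ℂ) * (p * p⁻¹) by ring, hpi,
      mul_one, map_mul, ofPowerSeries_X, ← mul_assoc, single_mul_single]
    simp
  rw [residue, this, coeff_single_mul, one_mul, sub_self, ← Nat.cast_zero (R := ℤ),
    LaurentSeries.coeff_coe_powerSeries]
  have h1 : PowerSeries.constantCoeff (PowerSeries.rescale a (PowerSeries.exp ℂ)) = 1 := by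
    rw [← PowerSeries.coeff_zero_eq_constantCoeff_apply, PowerSeries.coeff_rescale]
    simp
  simp [hc, h1]

lemma residue_expQuot_succ (a : ℂ) (k : ℕ) :
    (k + 1 : ℂ) * residue (expQuot a (k + 2)) = (a - (k + 1)) * residue (expQuot a (k + 1)) := by
  have := coeff_deriv_neg_one (expQuot a (k + 1))
  rw [deriv_expQuot', coeff_sub, HahnSeries.coeff_smul, HahnSeries.coeff_smul, sub_eq_zero] at this
  simpa using this.symm

/-- This is the residue of `y ^ (m - 1) / (y - 1) ^ k dy` at `y = 1`, where the numerator is a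
polynomial of degree below `k - 1`. In the recursion, the factor `a - (k + 1)` vanishes at the step
from `m` to `m + 1`. -/
lemma residue_expQuot_eq_zero {m k : ℕ} (hm : 1 ≤ m) (hk : m < k) :
    residue (expQuot m k) = 0 := by
  induction k, hk using Nat.le_induction with
  | base =>
    obtain ⟨m, rfl⟩ := Nat.exists_eq_add_of_le' hm
    have := residue_expQuot_succ (m + 1 : ℕ) m
    push_cast at this
    rw [sub_self, zero_mul, mul_eq_zero] at this
    rcases this with h | h
    · exact absurd h (by exact_mod_cast m.succ_ne_zero)
    · push_cast; exact h
  | succ k hk ih =>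
    obtain ⟨k, rfl⟩ := Nat.exists_eq_add_of_le' (hm.trans (Nat.le_of_lt hk))
    have := residue_expQuot_succ m k
    rw [ih, mul_zero, mul_eq_zero] at this
    exact this.resolve_left (by exact_mod_cast k.succ_ne_zero)

lemma residue_expQuot_self {m : ℕ} (hm : 1 ≤ m) : residue (expQuot m m) = 1 := by
  induction m, hm using Nat.le_induction with
  | base => simpa using residue_expQuot_one 1
  | succ m hm ih =>
    have := expQuot_sub (m : ℂ) m
    have h2 := congrArg residue this
    rw [residue, coeff_sub, show (expQuot (m : ℂ) (m + 1)).coeff (-1) = 0 from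
      residue_expQuot_eq_zero hm (Nat.lt_succ_self m), ih, sub_zero] at h2
    exact_mod_cast h2

/-- No factor of the recursion vanishes unless `a` is a natural number. -/
lemma residue_expQuot_ne_zero {a : ℂ} (ha : ∀ m : ℕ, a ≠ m) (k : ℕ) :
    residue (expQuot a (k + 1)) ≠ 0 := by
  induction k with
  | zero => rw [zero_add, residue_expQuot_one]; exact one_ne_zero
  | succ k ih =>
    intro h
    have := residue_expQuot_succ a k
    rw [h, mul_zero, eq_comm, mul_eq_zero] at this
    rcases this with h' | h'
    · exact ha (k + 1) (by push_cast; linear_combination h')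
    · exact ih h'

end Exponentials

/-! ### Commutator and iterate formulas with arbitrary Laurent series as kernels. -/

section Residues

variable {V : Type u} [AddCommGroup V] [Module ℂ V] [VertexAlgebra V]

lemma exists_mode_eq_zero (u v : V) : ∃ N : ℕ, ∀ n : ℤ, N ≤ n → mode u n v = 0 := by
  refine ⟨(-((HahnModule.of ℂ).symm (Y u v)).order).toNat, fun n hn => ?_⟩
  refine VertexOperator.ncoeff_eq_zero_of_lt_order (Y u) n v ?_
  have := Int.self_le_toNat (-((HahnModule.of ℂ).symm (Y u v)).order)
  lia

lemma mode_add_left (u u' v : V) (n : ℤ) : mode (u + u') n v = mode u n v + mode u' n v := by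
  simp [mode]

lemma mode_smul_left (c : ℂ) (u v : V) (n : ℤ) : mode (c • u) n v = c • mode u n v := by
  simp [mode]

lemma mode_vac_left (n : ℤ) (v : V) : mode vac n v = if n = -1 then v else 0 := vac_mode n v

lemma mode_vac_right (v : V) {n : ℤ} (hn : -1 ≤ n) : mode v n vac = if n = -1 then v else 0 :=
  mode_vac v n hn

lemma support_res_finite (f : LaurentSeries ℂ) (u v : V) :
    (Function.support fun j : ℤ => f.coeff j • mode u j v).Finite := by
  obtain ⟨a, ha⟩ := exists_vanishesBelow f
  obtain ⟨b, hb⟩ := exists_mode_eq_zero u v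
  refine (Set.finite_Icc a b).subset fun i hi => ?_
  by_contra h
  simp only [Set.mem_Icc, not_and_or, not_le] at h
  rcases h with h | h
  · exact hi (by simp [ha i h])
  · exact hi (by simp [hb i h.le])

/-- `Res_x f(x) Y(u, x) v`, as a linear map in `f`. -/
def resSeries (u v : V) : LaurentSeries ℂ →ₗ[ℂ] V where
  toFun f := res f u v
  map_add' f g := by
    simp only [res, coeff_add, add_smul]
    exact finsum_add_distrib (support_res_finite f u v) (support_res_finite g u v)
  map_smul' c f := by
    simp only [res, HahnSeries.coeff_smul, smul_assoc, RingHom.id_apply]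
    rw [smul_finsum]

/-- `Res_x f(x) Y(u, x) v`, as a bilinear map in `u` and `v`. -/
def resHom (f : LaurentSeries ℂ) : V →ₗ[ℂ] V →ₗ[ℂ] V :=
  LinearMap.mk₂ ℂ (res f)
    (fun u u' v => by
      simp only [res, mode_add_left, smul_add]
      exact finsum_add_distrib (support_res_finite f u v) (support_res_finite f u' v))
    (fun c u v => by
      simp only [res, mode_smul_left, smul_comm _ c]
      rw [smul_finsum])
    (fun u v v' => by
      simp only [res, map_add, smul_add]
      exact finsum_add_distrib (support_res_finite f u v) (support_res_finite f u v'))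
    (fun c u v => by
      simp only [res, map_smul, smul_comm _ c]
      rw [smul_finsum])

lemma resHom_apply (f : LaurentSeries ℂ) (u v : V) : resHom f u v = res f u v := rfl

lemma resSeries_apply (f : LaurentSeries ℂ) (u v : V) : resSeries u v f = res f u v := rfl

lemma res_zero_right (f : LaurentSeries ℂ) (u : V) : res f u 0 = 0 := map_zero (resHom f u)

lemma res_single (m : ℤ) (c : ℂ) (u v : V) : res (single m c) u v = c • mode u m v := by
  rw [res, finsum_eq_single _ m fun j hj => by simp [hj]]
  simp

lemma res_eq_zero {N : ℤ} {f : LaurentSeries ℂ} (hf : VanishesBelow N f) {u v : V}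
    (h : ∀ m, N ≤ m → mode u m v = 0) : res f u v = 0 := by
  refine finsum_eq_zero_of_forall_eq_zero fun j => ?_
  rcases lt_or_ge j N with hj | hj
  · rw [hf j hj, zero_smul]
  · rw [h j hj, smul_zero]

lemma finsum_nat_eq_sum_range {U : Type*} [AddCommMonoid U] {F : ℕ → U} {J : ℕ}
    (h : ∀ j, J ≤ j → F j = 0) : ∑ᶠ j, F j = ∑ j ∈ Finset.range J, F j := by
  refine finsum_eq_sum_of_support_subset _ fun j hj => ?_
  rw [Finset.coe_range, Set.mem_Iio]
  by_contra hc
  exact hj (h j (not_lt.1 hc))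

lemma finsum_choose_zero {U : Type*} [AddCommGroup U] (F : ℕ → U) :
    ∑ᶠ j : ℕ, Ring.choose (0 : ℤ) j • F j = F 0 := by
  rw [finsum_eq_single _ 0 fun j hj => ?_]
  · simp
  · obtain ⟨j, rfl⟩ := Nat.exists_eq_succ_of_ne_zero hj
    rw [Ring.choose_zero_succ, zero_smul]

/-- The commutator formula. -/
lemma mode_comm (u v w : V) (m n : ℤ) :
    mode u m (mode v n w) - mode v n (mode u m w) =
      ∑ᶠ j : ℕ, Ring.choose m j • mode (mode u j v) (m + n - j) w := by
  have h := jacobi u v w 0 m n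
  have h1 : ∀ j : ℕ, (-1 : ℤ) ^ j • Ring.choose (0 : ℤ) j •
      VertexOperator.ncoeff (Y u) (m + 0 - j) (VertexOperator.ncoeff (Y v) (n + j) w) =
      Ring.choose (0 : ℤ) j • ((-1 : ℤ) ^ j •
      VertexOperator.ncoeff (Y u) (m + 0 - j) (VertexOperator.ncoeff (Y v) (n + j) w)) :=
    fun j => smul_comm _ _ _
  have h2 : ∀ j : ℕ, (Int.negOnePow (0 + j) : ℤ) • Ring.choose (0 : ℤ) j •
      VertexOperator.ncoeff (Y v) (n + 0 - j) (VertexOperator.ncoeff (Y u) (m + j) w) =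
      Ring.choose (0 : ℤ) j • ((Int.negOnePow (0 + j) : ℤ) •
      VertexOperator.ncoeff (Y v) (n + 0 - j) (VertexOperator.ncoeff (Y u) (m + j) w)) :=
    fun j => smul_comm _ _ _
  rw [finsum_congr h1, finsum_congr h2, finsum_choose_zero, finsum_choose_zero] at h
  simpa [mode] using h

/-- The iterate formula. -/
lemma mode_iterate (u v w : V) (k n : ℤ) :
    mode (mode u k v) n w =
      (∑ᶠ j : ℕ, (-1 : ℤ) ^ j • Ring.choose k j • mode u (k - j) (mode v (n + j) w)) -
      ∑ᶠ j : ℕ, (Int.negOnePow (k + j) : ℤ) • Ring.choose k j •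
        mode v (n + k - j) (mode u j w) := by
  have h := jacobi u v w k 0 n
  rw [finsum_choose_zero] at h
  simpa [mode] using h.symm

lemma hasseDeriv_single_eq (j : ℕ) (m : ℤ) :
    LaurentSeries.hasseDeriv ℂ j (single m (1 : ℂ)) = single (m - j) ((Ring.choose m j : ℤ) : ℂ) := by
  rw [LaurentSeries.hasseDeriv_single]
  simp

lemma negX_single (m : ℤ) (c : ℂ) : negX (single m c) = single m ((-1) ^ m * c) := by
  ext n
  rw [coeff_negX]
  by_cases h : n = m
  · subst h; simp
  · simp [h]

lemma negOnePow_smul {U : Type*} [AddCommGroup U] [Module ℂ U] (k : ℤ) (x : U) :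
    (Int.negOnePow k : ℤ) • x = (-1 : ℂ) ^ k • x := by
  rw [← Int.cast_smul_eq_zsmul ℂ]
  congr 1
  rcases Int.even_or_odd k with h | h
  · rw [Int.negOnePow_even _ h, h.neg_one_zpow]; simp
  · rw [Int.negOnePow_odd _ h, h.neg_one_zpow]; simp

/-- Both sides are linear in `f` and `h` and ignore high degrees, so `eq_zero_of_monomials` reduces
the claim to `mode_comm`; Hasse derivatives encode its binomial coefficients. -/
lemma res_comm (u v w : V) (f h : LaurentSeries ℂ) {J : ℕ}
    (hJ : ∀ j : ℤ, J ≤ j → mode u j v = 0) :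
    res f u (res h v w) - res h v (res f u w) =
      ∑ j ∈ Finset.range J, res (LaurentSeries.hasseDeriv ℂ j f * h) (mode u j v) w := by
  have hJ' : ∀ j : ℕ, J ≤ j → mode u j v = 0 := fun j hj => hJ j (by exact_mod_cast hj)
  have hmono : ∀ m : ℤ, ∀ h : LaurentSeries ℂ,
      res (single m 1) u (res h v w) - res h v (res (single m 1) u w) =
      ∑ j ∈ Finset.range J,
        res (LaurentSeries.hasseDeriv ℂ j (single m (1 : ℂ)) * h) (mode u j v) w := by
    intro m h
    obtain ⟨N, hN⟩ := exists_vanishesBelow h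
    let L : LaurentSeries ℂ →ₗ[ℂ] V :=
      resHom (single m 1) u ∘ₗ resSeries v w - resSeries v (res (single m 1) u w) -
        ∑ j ∈ Finset.range J, resSeries (mode u j v) w ∘ₗ
          LinearMap.mulLeft ℂ (LaurentSeries.hasseDeriv ℂ j (single m (1 : ℂ)))
    obtain ⟨M₁, hM₁⟩ := exists_mode_eq_zero v w
    obtain ⟨M₂, hM₂⟩ := exists_mode_eq_zero v (res (single m 1) u w)
    choose M₃ hM₃ using fun j : ℕ => exists_mode_eq_zero (mode u j v) w
    have hL : L h = 0 := by
      -- Series vanishing below this degree meet only vanishing modes; `|m - j|` compensates for the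
      -- factor of degree `m - j`.
      refine eq_zero_of_monomials L (M := max (max M₁ M₂)
        (∑ j ∈ Finset.range J, ((M₃ j : ℤ) + |m - j|))) ?_ ?_ hN
      · intro n _
        simp only [L, LinearMap.sub_apply, LinearMap.comp_apply, resSeries_apply, resHom_apply,
          LinearMap.sum_apply, LinearMap.mulLeft_apply, hasseDeriv_single_eq, single_mul_single,
          res_single, one_smul, mul_one]
        rw [mode_comm, finsum_nat_eq_sum_range (J := J), sub_eq_zero]
        · refine Finset.sum_congr rfl fun j _ => ?_
          rw [Int.cast_smul_eq_zsmul, sub_add_eq_add_sub]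
        · intro j hj
          rw [hJ' j hj]; simp [mode]
      · intro g hg
        simp only [L, LinearMap.sub_apply, LinearMap.comp_apply, resSeries_apply, resHom_apply,
          LinearMap.sum_apply, LinearMap.mulLeft_apply]
        rw [res_eq_zero (u := v) (v := w) hg fun k hk => hM₁ k (by lia),
          res_eq_zero (u := v) (v := res _ u w) hg fun k hk => hM₂ k (by lia),
          Finset.sum_eq_zero fun j hj => ?_]
        · simp [res_zero_right]
        · have hv : VanishesBelow (m - j)
              (LaurentSeries.hasseDeriv ℂ j (single m (1 : ℂ))) := by
            rw [hasseDeriv_single_eq]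
            intro k hk
            rw [coeff_single_of_ne hk.ne]
          refine res_eq_zero (hv.mul hg) fun k hk => hM₃ j k ?_
          have := Finset.single_le_sum (f := fun j : ℕ => (M₃ j : ℤ) + |m - j|)
            (fun i _ => by positivity) hj
          have h2 := neg_abs_le (m - (j : ℤ))
          lia
    simp only [L, LinearMap.sub_apply, LinearMap.comp_apply, resSeries_apply, resHom_apply,
          LinearMap.sum_apply, LinearMap.mulLeft_apply] at hL
    exact sub_eq_zero.1 hL
  obtain ⟨N, hN⟩ := exists_vanishesBelow f
  obtain ⟨N', hN'⟩ := exists_vanishesBelow h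
  let L : LaurentSeries ℂ →ₗ[ℂ] V :=
      resSeries u (res h v w) - resHom h v ∘ₗ resSeries u w -
        ∑ j ∈ Finset.range J, resSeries (mode u j v) w ∘ₗ
          LinearMap.mulRight ℂ h ∘ₗ LaurentSeries.hasseDeriv ℂ j
  obtain ⟨M₁, hM₁⟩ := exists_mode_eq_zero u (res h v w)
  obtain ⟨M₂, hM₂⟩ := exists_mode_eq_zero u w
  choose M₃ hM₃ using fun j : ℕ => exists_mode_eq_zero (mode u j v) w
  have hL : L f = 0 := by
    refine eq_zero_of_monomials L (M := max (max M₁ M₂)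
        (∑ j ∈ Finset.range J, ((M₃ j : ℤ) + |N' - j|))) ?_ ?_ hN
    · intro m _
      simp only [L, LinearMap.sub_apply, LinearMap.comp_apply, resSeries_apply, resHom_apply,
          LinearMap.sum_apply, LinearMap.mulRight_apply]
      rw [hmono, sub_self]
    · intro g hg
      simp only [L, LinearMap.sub_apply, LinearMap.comp_apply, resSeries_apply, resHom_apply,
          LinearMap.sum_apply, LinearMap.mulRight_apply]
      rw [res_eq_zero (u := u) (v := res _ v w) hg fun k hk => hM₁ k (by lia),
          res_eq_zero (u := u) (v := w) hg fun k hk => hM₂ k (by lia),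
          Finset.sum_eq_zero fun j hj => ?_]
      · simp [res_zero_right]
      · refine res_eq_zero ((hg.hasseDeriv j).mul hN') fun k hk => hM₃ j k ?_
        have := Finset.single_le_sum (f := fun j : ℕ => (M₃ j : ℤ) + |N' - j|)
            (fun i _ => by positivity) hj
        have h2 := neg_abs_le (N' - (j : ℤ))
        lia
  simp only [L, LinearMap.sub_apply, LinearMap.comp_apply, resSeries_apply, resHom_apply,
          LinearMap.sum_apply, LinearMap.mulRight_apply] at hL
  exact sub_eq_zero.1 hL

/-- The two sums are the Taylor expansions of `f(x₁ - x₂)` in powers of `x₂` and in powers of `x₁`.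
As `x ^ j h` vanishes below `N + j`, the bound `J` truncates the first sum. -/
lemma res_iterate (u v w : V) (f h : LaurentSeries ℂ) {J J' : ℕ} {N : ℤ}
    (hh : VanishesBelow N h) (hJ : ∀ j : ℤ, N + J ≤ j → mode v j w = 0)
    (hJ' : ∀ j : ℤ, J' ≤ j → mode u j w = 0) :
    res h (res f u v) w =
      ∑ j ∈ Finset.range J, (-1 : ℂ) ^ j •
        res (LaurentSeries.hasseDeriv ℂ j f) u (res (single (j : ℤ) 1 * h) v w) -
      ∑ j ∈ Finset.range J', res (negX (LaurentSeries.hasseDeriv ℂ j f) * h) v (mode u j w) := by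
  have hmono : ∀ m : ℤ, res h (res (single m 1) u v) w =
      ∑ j ∈ Finset.range J, (-1 : ℂ) ^ j •
        res (LaurentSeries.hasseDeriv ℂ j (single m (1 : ℂ))) u (res (single (j : ℤ) 1 * h) v w) -
      ∑ j ∈ Finset.range J',
        res (negX (LaurentSeries.hasseDeriv ℂ j (single m (1 : ℂ))) * h) v (mode u j w) := by
    intro m
    let L : LaurentSeries ℂ →ₗ[ℂ] V :=
      resSeries (res (single m 1) u v) w -
      (∑ j ∈ Finset.range J, (-1 : ℂ) ^ j •
        resHom (LaurentSeries.hasseDeriv ℂ j (single m (1 : ℂ))) u ∘ₗ resSeries v w ∘ₗ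
          LinearMap.mulLeft ℂ (single (j : ℤ) 1) -
      ∑ j ∈ Finset.range J', resSeries v (mode u j w) ∘ₗ
        LinearMap.mulLeft ℂ (negX (LaurentSeries.hasseDeriv ℂ j (single m (1 : ℂ)))))
    obtain ⟨M₁, hM₁⟩ := exists_mode_eq_zero (res (single m 1) u v) w
    obtain ⟨M₂, hM₂⟩ := exists_mode_eq_zero v w
    choose M₃ hM₃ using fun j : ℕ => exists_mode_eq_zero v (mode u j w)
    have hL : L h = 0 := by
      refine eq_zero_of_monomials L (M := max (max M₁ M₂)
        (∑ j ∈ Finset.range J', ((M₃ j : ℤ) + |m - j|))) ?_ ?_ hh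
      · intro n hn
        simp only [L, LinearMap.sub_apply, LinearMap.comp_apply, resSeries_apply, resHom_apply,
          LinearMap.sum_apply, LinearMap.smul_apply, LinearMap.mulLeft_apply,
          hasseDeriv_single_eq, negX_single, single_mul_single, res_single, one_smul, mul_one]
        rw [mode_iterate, finsum_nat_eq_sum_range (J := J), finsum_nat_eq_sum_range (J := J'),
          sub_eq_zero]
        · congr 1
          · refine Finset.sum_congr rfl fun j _ => ?_
            rw [Int.cast_smul_eq_zsmul, ← Int.cast_smul_eq_zsmul ℂ ((-1) ^ j), add_comm n]
            simp
          · refine Finset.sum_congr rfl fun j _ => ?_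
            rw [negOnePow_smul, mul_smul, Int.cast_smul_eq_zsmul,
              show n + m - j = m - j + n by ring, show m + j = m - j + (j + j : ℤ) by ring,
              zpow_add₀ (by norm_num) _ (j + j : ℤ), Even.neg_one_zpow ⟨(j : ℤ), rfl⟩, mul_one]
        · intro j hj
          rw [hJ' j (by exact_mod_cast hj)]
          simp
        · intro j hj
          rw [hJ (n + j) (by lia)]
          simp
      · intro g hg
        simp only [L, LinearMap.sub_apply, LinearMap.comp_apply, resSeries_apply, resHom_apply,
          LinearMap.sum_apply, LinearMap.smul_apply, LinearMap.mulLeft_apply]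
        have hs : ∀ (k : ℤ) (c : ℂ), VanishesBelow k (single k c) := fun k c i hi => by
          rw [coeff_single_of_ne hi.ne]
        rw [res_eq_zero hg fun k hk => hM₁ k (by lia), Finset.sum_eq_zero fun j hj => ?_,
          Finset.sum_eq_zero fun j hj => ?_, sub_zero, sub_zero]
        · rw [hasseDeriv_single_eq, negX_single]
          refine res_eq_zero ((hs _ _).mul hg) fun k hk => hM₃ j k ?_
          have := Finset.single_le_sum (f := fun j : ℕ => (M₃ j : ℤ) + |m - j|)
            (fun i _ => by positivity) hj
          have h2 := neg_abs_le (m - (j : ℤ))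
          lia
        · rw [res_eq_zero ((hs j 1).mul hg) fun k hk => hM₂ k (by lia), res_zero_right, smul_zero]
    simp only [L, LinearMap.sub_apply, LinearMap.comp_apply, resSeries_apply, resHom_apply,
          LinearMap.sum_apply, LinearMap.smul_apply, LinearMap.mulLeft_apply] at hL
    exact sub_eq_zero.1 hL
  obtain ⟨N', hN'⟩ := exists_vanishesBelow f
  let negXL : LaurentSeries ℂ →ₗ[ℂ] LaurentSeries ℂ :=
    { toFun := negX, map_add' := map_add negX, map_smul' := negX_smul }
  have negXL_apply : ∀ f, negXL f = negX f := fun _ => rfl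
  let L : LaurentSeries ℂ →ₗ[ℂ] V :=
      (resHom h).flip w ∘ₗ resSeries u v -
      (∑ j ∈ Finset.range J, (-1 : ℂ) ^ j •
        resSeries u (res (single (j : ℤ) 1 * h) v w) ∘ₗ LaurentSeries.hasseDeriv ℂ j -
      ∑ j ∈ Finset.range J', resSeries v (mode u j w) ∘ₗ LinearMap.mulRight ℂ h ∘ₗ negXL ∘ₗ
        LaurentSeries.hasseDeriv ℂ j)
  obtain ⟨M₁, hM₁⟩ := exists_mode_eq_zero u v
  choose M₂ hM₂ using fun j : ℕ => exists_mode_eq_zero u (res (single (j : ℤ) 1 * h) v w)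
  choose M₃ hM₃ using fun j : ℕ => exists_mode_eq_zero v (mode u j w)
  have hL : L f = 0 := by
    refine eq_zero_of_monomials L (M := max (max M₁ (∑ j ∈ Finset.range J, ((M₂ j : ℤ) + j)))
        (∑ j ∈ Finset.range J', ((M₃ j : ℤ) + |N - j|))) ?_ ?_ hN'
    · intro m _
      simp only [L, LinearMap.sub_apply, LinearMap.comp_apply, resSeries_apply, resHom_apply,
          LinearMap.sum_apply, LinearMap.smul_apply, LinearMap.mulRight_apply, negXL_apply,
          LinearMap.flip_apply]
      rw [hmono, sub_self]
    · intro g hg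
      simp only [L, LinearMap.sub_apply, LinearMap.comp_apply, resSeries_apply, resHom_apply,
          LinearMap.sum_apply, LinearMap.smul_apply, LinearMap.mulRight_apply, negXL_apply,
          LinearMap.flip_apply]
      rw [res_eq_zero hg fun k hk => hM₁ k (by lia), Finset.sum_eq_zero fun j hj => ?_,
          Finset.sum_eq_zero fun j hj => ?_, sub_zero, sub_zero, ← resHom_apply, map_zero,
          LinearMap.zero_apply]
      · refine res_eq_zero ((hg.hasseDeriv j).negX.mul hh) fun k hk => hM₃ j k ?_
        have := Finset.single_le_sum (f := fun j : ℕ => (M₃ j : ℤ) + |N - j|)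
            (fun i _ => by positivity) hj
        have h2 := neg_abs_le (N - (j : ℤ))
        lia
      · rw [res_eq_zero (hg.hasseDeriv j) fun k hk => hM₂ j k ?_, smul_zero]
        have := Finset.single_le_sum (f := fun j : ℕ => (M₂ j : ℤ) + j)
            (fun i _ => by positivity) hj
        lia
  simp only [L, LinearMap.sub_apply, LinearMap.comp_apply, resSeries_apply, resHom_apply,
          LinearMap.sum_apply, LinearMap.smul_apply, LinearMap.mulRight_apply, negXL_apply,
          LinearMap.flip_apply] at hL
  exact sub_eq_zero.1 hL

end Residues

/-! ### The operator `𝒟` and skew-symmetry modulo `𝒟 V`. -/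

section Translation

variable {V : Type u} [AddCommGroup V] [Module ℂ V] [VertexAlgebra V]

/-- The operator `𝒟` as a linear map. -/
def opDHom : V →ₗ[ℂ] V where
  toFun := opD
  map_add' u v := mode_add_left u v vac (-2)
  map_smul' c v := mode_smul_left c v vac (-2)

lemma opD_mem_range (v : V) : opD v ∈ LinearMap.range (opDHom (V := V)) := ⟨v, rfl⟩

lemma choose_neg_two (j : ℕ) : Ring.choose (-2 : ℤ) j = (-1) ^ j * (j + 1) := by
  rw [Ring.choose_neg, show (2 : ℤ) + j - 1 = ((j + 1 : ℕ) : ℤ) by push_cast; ring,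
    Ring.choose_natCast, Nat.choose_succ_self_right, Units.smul_def, smul_eq_mul]
  simp [Int.negOnePow]

/-- In the iterate formula with second argument the vacuum, at most one term survives: in the first
sum for `n ≤ -1`, in the second for `n ≥ 1`, none for `n = 0`. -/
lemma mode_opD_left (u v : V) (n : ℤ) : mode (opD u) n v = -(n : ℂ) • mode u (n - 1) v := by
  have h := mode_iterate u vac v (-2) n
  have h1 : (∑ᶠ j : ℕ, (-1 : ℤ) ^ j • Ring.choose (-2 : ℤ) j •
      mode u (-2 - j) (mode vac (n + j) v)) = if n ≤ -1 then -(n : ℂ) • mode u (n - 1) v else 0 := by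
    split_ifs with hn
    · obtain ⟨i, rfl⟩ : ∃ i : ℕ, n = -1 - i := ⟨(-1 - n).toNat, by lia⟩
      rw [finsum_eq_single _ i fun j hj => ?_]
      · rw [mode_vac_left, if_pos (by ring), choose_neg_two, smul_smul, ← mul_assoc, ← mul_pow,
          show (-2 - (i : ℤ)) = -1 - i - 1 by ring, ← Int.cast_smul_eq_zsmul ℂ]
        congr 1
        push_cast
        ring
      · rw [mode_vac_left, if_neg (by lia)]
        simp
    · refine finsum_eq_zero_of_forall_eq_zero fun j => ?_
      rw [mode_vac_left, if_neg (by lia)]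
      simp
  have h2 : (∑ᶠ j : ℕ, (Int.negOnePow (-2 + j) : ℤ) • Ring.choose (-2 : ℤ) j •
        mode vac (n + -2 - j) (mode u j v)) =
        if n ≤ -1 then 0 else (n : ℂ) • mode u (n - 1) v := by
    split_ifs with hn
    · refine finsum_eq_zero_of_forall_eq_zero fun j => ?_
      rw [mode_vac_left, if_neg (by lia)]
      simp
    · rcases eq_or_lt_of_le (show 0 ≤ n by lia) with h0 | h0
      · obtain rfl : n = 0 := by lia
        rw [Int.cast_zero, zero_smul]
        refine finsum_eq_zero_of_forall_eq_zero fun j => ?_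
        rw [mode_vac_left, if_neg (by lia)]
        simp
      · obtain ⟨i, rfl⟩ : ∃ i : ℕ, n = i + 1 := ⟨(n - 1).toNat, by lia⟩
        rw [finsum_eq_single _ i fun j hj => ?_]
        · rw [mode_vac_left, if_pos (by ring), choose_neg_two, negOnePow_smul,
            ← Int.cast_smul_eq_zsmul ℂ, smul_smul, add_sub_cancel_right,
            zpow_add₀ (by norm_num)]
          congr 1
          push_cast
          rw [zpow_natCast, mul_assoc, ← mul_assoc ((-1 : ℂ) ^ i), ← mul_pow]
          norm_num
        · rw [mode_vac_left, if_neg (by lia)]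
          simp
  rw [h1, h2] at h
  change mode (mode u (-2) vac) n v = _
  rw [h]
  split_ifs <;> simp

lemma opD_mode (u v : V) (n : ℤ) : opD (mode u n v) = mode (opD u) n v + mode u n (opD v) := by
  have h := mode_iterate u v vac n (-2)
  rw [finsum_nat_eq_sum_range (J := 2), finsum_eq_zero_of_forall_eq_zero, sub_zero,
    Finset.sum_range_succ, Finset.sum_range_one] at h
  · rw [mode_opD_left]
    simp only [pow_zero, Ring.choose_zero_right, Nat.cast_zero, sub_zero, add_zero, one_smul,
      pow_one, Ring.choose_one_right, Nat.cast_one] at h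
    rw [show (-2 + 1 : ℤ) = -1 by norm_num, mode_vac_right v le_rfl, if_pos rfl] at h
    rw [opD, h, opD, add_comm, ← Int.cast_smul_eq_zsmul ℂ n]
    simp
  · intro j
    rw [mode_vac_right u (by lia), if_neg (by lia)]
    simp
  · intro j hj
    rw [mode_vac_right v (by lia), if_neg (by lia)]
    simp

/-- Replacing `a` by `𝒟 a` lowers the mode by one, at the cost of a factor that is nonzero for modes
at most `-2`. -/
lemma mode_vac_mem_range (j : ℕ) (a : V) :
    mode a (-2 - j) vac ∈ LinearMap.range (opDHom (V := V)) := by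
  induction j generalizing a with
  | zero => rw [Nat.cast_zero, sub_zero]; exact opD_mem_range a
  | succ j ih =>
    have h := ih (opD a)
    rw [mode_opD_left, show (-2 - (j : ℤ) - 1) = -2 - (j + 1 : ℕ) by push_cast; ring] at h
    refine (Submodule.smul_mem_iff _ ?_).1 h
    have : (-2 - (j : ℤ)) ≠ 0 := by lia
    rw [neg_ne_zero]
    exact_mod_cast this

lemma mode_skew (u v : V) (n : ℤ) :
    mode u n v + (-1 : ℂ) ^ n • mode v n u ∈ LinearMap.range (opDHom (V := V)) := by
  -- For these indices the creation property leaves only `j = 0` in both sums on the left; the right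
  -- side consists of modes `a_{-2-j} 𝟏`.
  have h := jacobi u v vac (n + 1) (-1) (-1)
  change (∑ᶠ j : ℕ, (-1 : ℤ) ^ j • Ring.choose (n + 1) j •
        mode u (-1 + (n + 1) - j) (mode v (-1 + j) vac))
      - (∑ᶠ j : ℕ, (Int.negOnePow (n + 1 + j) : ℤ) • Ring.choose (n + 1) j •
        mode v (-1 + (n + 1) - j) (mode u (-1 + j) vac))
      = ∑ᶠ j : ℕ, Ring.choose (-1 : ℤ) j •
        mode (mode u (n + 1 + j) v) (-1 + -1 - j) vac at h
  rw [finsum_nat_eq_sum_range (J := 1), finsum_nat_eq_sum_range (J := 1),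
    Finset.sum_range_one, Finset.sum_range_one, mode_vac_right v (by simp),
    mode_vac_right u (by simp), negOnePow_smul] at h
  · have e : mode u n v + (-1 : ℂ) ^ n • mode v n u =
      ∑ᶠ j : ℕ, Ring.choose (-1 : ℤ) j • mode (mode u (n + 1 + j) v) (-1 + -1 - j) vac := by
      rw [← h, zpow_add₀ (by norm_num), zpow_add₀ (by norm_num)]
      simp
    rw [e]
    refine finsum_induction (· ∈ LinearMap.range (opDHom (V := V))) (zero_mem _)
      (fun _ _ => add_mem) fun j => zsmul_mem (mode_vac_mem_range j _) _
  · intro j hj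
    rw [mode_vac_right u (by lia), if_neg (by lia)]
    simp
  · intro j hj
    rw [mode_vac_right v (by lia), if_neg (by lia)]
    simp

lemma res_opD_left (f : LaurentSeries ℂ) (u v : V) :
    res f (opD u) v = -res (deriv f) u v := by
  rw [res, res, ← finsum_neg_distrib,
    ← finsum_comp_equiv (Equiv.addRight (-1 : ℤ)) (f := fun j => -((deriv f).coeff j • _))]
  refine finsum_congr fun j => ?_
  simp only [coeff_deriv, Equiv.coe_addRight]
  rw [mode_opD_left, smul_smul, show j + -1 + 1 = j by ring, show j + -1 = j - 1 by ring, ← neg_smul]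
  congr 1
  push_cast
  ring

lemma opD_res (f : LaurentSeries ℂ) (u v : V) :
    opD (res f u v) = res f (opD u) v + res f u (opD v) := by
  have h : opD (res f u v) = opDHom (res f u v) := rfl
  rw [h, res, map_finsum _ (support_res_finite f u v), res, res,
    ← finsum_add_distrib (support_res_finite f (opD u) v) (support_res_finite f u (opD v))]
  refine finsum_congr fun j => ?_
  rw [map_smul, ← smul_add, ← opD_mode]
  rfl

lemma res_skew (f : LaurentSeries ℂ) (u v : V) :
    res f u v + res (negX f) v u ∈ LinearMap.range (opDHom (V := V)) := by
  rw [res, res, ← finsum_add_distrib (support_res_finite f u v) (support_res_finite (negX f) v u)]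
  refine finsum_induction (· ∈ LinearMap.range (opDHom (V := V))) (zero_mem _)
      (fun _ _ => add_mem) fun j => ?_
  rw [coeff_negX, mul_comm, mul_smul, ← smul_add]
  exact Submodule.smul_mem _ _ (mode_skew u v j)

lemma res_vac_left (f : LaurentSeries ℂ) (v : V) : res f vac v = residue f • v := by
  rw [res, finsum_eq_single _ (-1) fun j hj => ?_]
  · rw [mode_vac_left, if_pos rfl]
  · rw [mode_vac_left, if_neg hj, smul_zero]

lemma res_vac_right (f : LaurentSeries ℂ) (v : V) :
    res f v vac - residue f • v ∈ LinearMap.range (opDHom (V := V)) := by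
  have h := res_skew (negX f) vac v
  rw [negX_negX, res_vac_left, residue, coeff_negX] at h
  convert h using 1
  rw [zpow_neg_one, inv_neg, inv_one, neg_one_mul, neg_smul]
  abel

end Translation

/-! ### Rational functions of `y = e ^ x` behind `◇` and `•`. -/

section RationalFunctions

/-- The series defining `•`: `∑ i ≤ ℓ, (-1) ^ i (ℓ + i choose i) e ^ ((ℓ + 1) x) /
(e ^ x - 1) ^ (ℓ + i + 1)`. -/
def bulletSeries (l : ℕ) : LaurentSeries ℂ :=
  ∑ i ∈ Finset.range (l + 1), ((-1 : ℂ) ^ i * ((l + i).choose i : ℂ)) •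
    expQuot ((l : ℂ) + 1) (l + i + 1)

/-- The rational functions of `y = e ^ x` that are regular away from `y = 1`, including at `0`
and `∞`. -/
def regularSeries : Submodule ℂ (LaurentSeries ℂ) :=
  Submodule.span ℂ {f | ∃ a k : ℕ, a ≤ k ∧ f = expQuot a k}

/-- The span of the `e ^ ((q + s) x) / (e ^ x - 1) ^ k` with `α ≤ q` and `q + β ≤ k`. -/
def decayingSeries (s : ℂ) (α β : ℕ) : Submodule ℂ (LaurentSeries ℂ) :=
  Submodule.span ℂ {f | ∃ q k : ℕ, α ≤ q ∧ q + β ≤ k ∧ f = expQuot (q + s) k}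

lemma expQuot_mem_regularSeries {a k : ℕ} (h : a ≤ k) : expQuot a k ∈ regularSeries :=
  Submodule.subset_span ⟨a, k, h, rfl⟩

lemma expQuot_mem_decayingSeries (s : ℂ) {α β q k : ℕ} (h : α ≤ q) (h' : q + β ≤ k) :
    expQuot (q + s) k ∈ decayingSeries s α β :=
  Submodule.subset_span ⟨q, k, h, h', rfl⟩

/-- Orders of vanishing at `y = 0` and `y = ∞` add, and those of regular series are nonnegative. -/
lemma mul_mem_decayingSeries {s : ℂ} {α β : ℕ} {f h : LaurentSeries ℂ} (hf : f ∈ regularSeries)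
    (hh : h ∈ decayingSeries s α β) : f * h ∈ decayingSeries s α β := by
  induction hf using Submodule.span_induction with
  | mem f hf =>
    obtain ⟨a, k, hak, rfl⟩ := hf
    induction hh using Submodule.span_induction with
    | mem h hh =>
      obtain ⟨q, k', hq, hk, rfl⟩ := hh
      rw [expQuot_mul, ← add_assoc, ← Nat.cast_add]
      exact expQuot_mem_decayingSeries s (by lia) (by lia)
    | zero => rw [mul_zero]; exact zero_mem _
    | add x y _ _ hx hy => rw [mul_add]; exact add_mem hx hy
    | smul c x _ hx => rw [mul_smul_comm]; exact Submodule.smul_mem _ _ hx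
  | zero => rw [zero_mul]; exact zero_mem _
  | add x y _ _ hx hy => rw [add_mul]; exact add_mem hx hy
  | smul c x _ hx => rw [smul_mul_assoc]; exact Submodule.smul_mem _ _ hx

lemma deriv_mem_decayingSeries {s : ℂ} {α β : ℕ} {h : LaurentSeries ℂ}
    (hh : h ∈ decayingSeries s α β) : deriv h ∈ decayingSeries s α β := by
  induction hh using Submodule.span_induction with
  | mem h hh =>
    obtain ⟨q, k', hq, hk, rfl⟩ := hh
    rw [deriv_expQuot, show (q + s + 1 : ℂ) = ((q + 1 : ℕ) : ℂ) + s by push_cast; ring]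
    exact sub_mem (Submodule.smul_mem _ _ (expQuot_mem_decayingSeries s hq hk))
      (Submodule.smul_mem _ _ (expQuot_mem_decayingSeries s (by lia) (by lia)))
  | zero => rw [map_zero]; exact zero_mem _
  | add x y _ _ hx hy => rw [map_add]; exact add_mem hx hy
  | smul c x _ hx => rw [map_smul]; exact Submodule.smul_mem _ _ hx

lemma negX_mem_regularSeries {h : LaurentSeries ℂ} (hh : h ∈ regularSeries) :
    negX h ∈ regularSeries := by
  induction hh using Submodule.span_induction with
  | mem h hh =>
    obtain ⟨a, k, hk, rfl⟩ := hh
    rw [negX_expQuot, ← Nat.cast_sub hk]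
    exact Submodule.smul_mem _ _ (expQuot_mem_regularSeries (Nat.sub_le _ _))
  | zero => rw [map_zero]; exact zero_mem _
  | add x y _ _ hx hy => rw [map_add]; exact add_mem hx hy
  | smul c x _ hx => rw [negX_smul]; exact Submodule.smul_mem _ _ hx

/-- The map `y ↦ y⁻¹` exchanges `0` and `∞`, so both orders are taken equal. -/
lemma negX_mem_decayingSeries {α : ℕ} {h : LaurentSeries ℂ} (hh : h ∈ decayingSeries 0 α α) :
    negX h ∈ decayingSeries 0 α α := by
  induction hh using Submodule.span_induction with
  | mem h hh =>
    obtain ⟨q, k, hq, hk, rfl⟩ := hh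
    rw [negX_expQuot, add_zero, ← Nat.cast_sub (by lia), ← add_zero ((k - q : ℕ) : ℂ)]
    exact Submodule.smul_mem _ _ (expQuot_mem_decayingSeries 0 (by lia) (by lia))
  | zero => rw [map_zero]; exact zero_mem _
  | add x y _ _ hx hy => rw [map_add]; exact add_mem hx hy
  | smul c x _ hx => rw [negX_smul]; exact Submodule.smul_mem _ _ hx

lemma deriv_mem_regularSeries {h : LaurentSeries ℂ} (hh : h ∈ regularSeries) :
    deriv h ∈ regularSeries := by
  induction hh using Submodule.span_induction with
  | mem h hh =>
    obtain ⟨a, k, hk, rfl⟩ := hh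
    rw [deriv_expQuot, ← Nat.cast_add_one]
    exact sub_mem (Submodule.smul_mem _ _ (expQuot_mem_regularSeries hk))
      (Submodule.smul_mem _ _ (expQuot_mem_regularSeries (by lia)))
  | zero => rw [map_zero]; exact zero_mem _
  | add x y _ _ hx hy => rw [map_add]; exact add_mem hx hy
  | smul c x _ hx => rw [map_smul]; exact Submodule.smul_mem _ _ hx

lemma hasseDeriv_mem_of_deriv_mem {S : Submodule ℂ (LaurentSeries ℂ)}
    (hS : ∀ f ∈ S, deriv f ∈ S) {f : LaurentSeries ℂ} (hf : f ∈ S) (j : ℕ) :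
    LaurentSeries.hasseDeriv ℂ j f ∈ S := by
  refine hasseDeriv_mem ?_
  induction j with
  | zero => exact hf
  | succ j ih => rw [Function.iterate_succ_apply']; exact hS _ ih

lemma hasseDeriv_succ_mem {S : Submodule ℂ (LaurentSeries ℂ)}
    (hS : ∀ f ∈ S, deriv f ∈ S) {f : LaurentSeries ℂ} (hf : deriv f ∈ S) (j : ℕ) :
    LaurentSeries.hasseDeriv ℂ (j + 1) f ∈ S := by
  refine hasseDeriv_mem ?_
  induction j with
  | zero => exact hf
  | succ j ih => rw [Function.iterate_succ_apply']; exact hS _ ih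

lemma bulletSeries_mem_regularSeries (l : ℕ) : bulletSeries l ∈ regularSeries := by
  refine sum_mem fun i _ => Submodule.smul_mem _ _ ?_
  rw [← Nat.cast_add_one]
  exact expQuot_mem_regularSeries (by lia)

/-- The binomial coefficients of `•` make the derivative telescope. The surviving term is a multiple
of the `◇` series for `r = 0`. -/
lemma deriv_bulletSeries (l : ℕ) : deriv (bulletSeries l) =
    ((l + 1 : ℂ) * ((-1) ^ (l + 1) * ((l + (l + 1)).choose (l + 1) : ℂ))) •
      expQuot ((l : ℂ) + 1) (l + (l + 1) + 1) := by
  have key : ∀ N : ℕ, deriv (∑ i ∈ Finset.range N, ((-1 : ℂ) ^ i * ((l + i).choose i : ℂ)) •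
    expQuot ((l : ℂ) + 1) (l + i + 1)) =
      ((N : ℂ) * ((-1) ^ N * ((l + N).choose N : ℂ))) • expQuot ((l : ℂ) + 1) (l + N + 1) := by
    intro N
    induction N with
    | zero =>
      rw [Finset.sum_range_zero, map_zero, Nat.cast_zero, zero_mul, ← C_mul_eq_smul, map_zero,
        zero_mul]
    | succ N ih =>
      rw [Finset.sum_range_succ, map_add, ih, map_smul, deriv_expQuot', smul_sub, smul_smul,
        smul_smul]
      have h := Nat.add_one_mul_choose_eq (l + N) N
      have h' : ((l + N : ℂ) + 1) * ((l + N).choose N : ℂ) =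
          ((l + N + 1).choose (N + 1) : ℂ) * (N + 1) := by exact_mod_cast h
      rw [show (((N + 1 : ℕ) : ℂ) * ((-1) ^ (N + 1) * ((l + (N + 1)).choose (N + 1) : ℂ))) =
        -(-1) ^ N * (((l + N : ℂ) + 1) * ((l + N).choose N : ℂ)) by
          rw [h', ← add_assoc]; push_cast; ring]
      push_cast
      rw [← add_assoc l N 1]
      module
  rw [bulletSeries, key]
  push_cast
  rfl

lemma deriv_bulletSeries_mem (l : ℕ) : deriv (bulletSeries l) ∈ decayingSeries 0 (l + 1) (l + 1) := by
  rw [deriv_bulletSeries, show (l + 1 : ℂ) = ((l + 1 : ℕ) : ℂ) + 0 by push_cast; ring]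
  exact Submodule.smul_mem _ _ (expQuot_mem_decayingSeries 0 le_rfl (by lia))

/-- Up to sign, `x ↦ -x` turns `y ^ (l + 1) / (y - 1) ^ (l + i + 1)` into `y ^ i / (y - 1) ^ (l + i
+ 1)`. So one factor vanishes to order `l + 1` at `∞`, the other at `0`. -/
lemma negX_bulletSeries_mul_mem (l : ℕ) :
    negX (bulletSeries l) * bulletSeries l ∈ decayingSeries 0 (l + 1) (l + 1) := by
  rw [bulletSeries, map_sum, Finset.sum_mul]
  refine sum_mem fun i _ => ?_
  rw [Finset.mul_sum]
  refine sum_mem fun j _ => ?_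
  rw [negX_smul, negX_expQuot, smul_mul_assoc, smul_mul_assoc, mul_smul_comm, expQuot_mul,
    show ((l + i + 1 : ℕ) : ℂ) - (l + 1) + (l + 1) = ((l + i + 1 : ℕ) : ℂ) + 0 by ring]
  exact Submodule.smul_mem _ _ (Submodule.smul_mem _ _ (Submodule.smul_mem _ _
    (expQuot_mem_decayingSeries 0 (by lia) (by lia))))

lemma residue_bulletSeries (l : ℕ) : residue (bulletSeries l) = 1 := by
  rw [residue, bulletSeries, HahnSeries.coeff_sum, Finset.sum_range_succ', Finset.sum_eq_zero]
  · rw [HahnSeries.coeff_smul, ← Nat.cast_add_one, add_zero]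
    have := residue_expQuot_self (m := l + 1) (by lia)
    rw [residue, Nat.cast_add_one] at this
    simp [this]
  · intro i _
    rw [HahnSeries.coeff_smul, ← Nat.cast_add_one]
    have := residue_expQuot_eq_zero (m := l + 1) (k := l + (i + 1) + 1) (by lia) (by lia)
    rw [residue] at this
    rw [this, smul_zero]

end RationalFunctions

/-! ### Stability properties of `Õ`, and associativity modulo it. -/

section ZhuIdeal

variable {V : Type u} [AddCommGroup V] [Module ℂ V] [VertexAlgebra V] {g : Aut V} {T : ℕ}

lemma mem_eigen {r : ℕ} {v : V} : v ∈ eigen g T r ↔ g.toLinearEquiv v = omegaT T ^ r • v :=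
  Module.End.mem_eigenspace_iff

lemma omegaT_isPrimitiveRoot (hT : 0 < T) : IsPrimitiveRoot (omegaT T) T := by
  have h := (Complex.isPrimitiveRoot_exp T hT.ne').inv
  rw [← Complex.exp_neg] at h
  rwa [omegaT, neg_mul, neg_mul, neg_div]

lemma omegaT_ne_zero (T : ℕ) : omegaT T ≠ 0 := Complex.exp_ne_zero _

lemma opD_mem_eigen {r : ℕ} {v : V} (hv : v ∈ eigen g T r) : opD v ∈ eigen g T r := by
  rw [mem_eigen] at hv ⊢
  rw [opD, g.map_mode, g.map_vac, hv, mode_smul_left]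

lemma map_res (f : LaurentSeries ℂ) (u v : V) :
    g.toLinearEquiv (res f u v) = res f (g.toLinearEquiv u) (g.toLinearEquiv v) := by
  rw [res, map_finsum _ (support_res_finite f u v), res]
  simp only [map_smul, g.map_mode]

lemma mode_mem_eigen {r : ℕ} {u v : V} (hu : u ∈ eigen g T 0) (hv : v ∈ eigen g T r) (n : ℤ) :
    mode u n v ∈ eigen g T r := by
  rw [mem_eigen] at hu hv ⊢
  rw [g.map_mode, hu, hv, pow_zero, one_smul, map_smul]

lemma opD_mem_zhuO (n : ℕ) (v : V) : opD v ∈ zhuO g T n :=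
  Submodule.subset_span (Or.inr ⟨v, rfl⟩)

lemma range_opDHom_le_zhuO (n : ℕ) : LinearMap.range opDHom ≤ zhuO g T n := by
  rintro _ ⟨v, rfl⟩
  exact opD_mem_zhuO n v

lemma diamond_mem_zhuO (n : ℕ) {r : ℕ} (hr : r < T) {u : V} (hu : u ∈ eigen g T r) (v : V) :
    diamond T n r u v ∈ zhuO g T n :=
  Submodule.subset_span (Or.inl ⟨r, hr, u, hu, v, rfl⟩)

/-- The series `h` with `Res_x h(x) Y(u, x) v ∈ Õ_{g, n}(V)` for all `u` in `V ^ r` and all `v`. -/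
def zhuAnnihilator (g : Aut V) (T n r : ℕ) : Submodule ℂ (LaurentSeries ℂ) :=
  ⨅ (u : eigen g T r) (v : V), (zhuO g T n).comap (resSeries u.1 v)

lemma mem_zhuAnnihilator {n r : ℕ} {h : LaurentSeries ℂ} :
    h ∈ zhuAnnihilator g T n r ↔ ∀ u ∈ eigen g T r, ∀ v : V, res h u v ∈ zhuO g T n := by
  simp [zhuAnnihilator, Submodule.mem_iInf, resSeries_apply]

lemma deriv_mem_zhuAnnihilator {n r : ℕ} {h : LaurentSeries ℂ}
    (hh : h ∈ zhuAnnihilator g T n r) : deriv h ∈ zhuAnnihilator g T n r := by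
  rw [mem_zhuAnnihilator] at hh ⊢
  intro u hu v
  rw [← neg_neg (res _ u v), ← res_opD_left]
  exact neg_mem (hh _ (opD_mem_eigen hu) v)

/-- The series spanned by those in `u ◇_{g, n} v`, for `u` in `V ^ r`, and the analogous ones with
higher orders of vanishing at `e ^ x = 0` and `e ^ x = ∞`. -/
abbrev diamondSeries (T n r : ℕ) : Submodule ℂ (LaurentSeries ℂ) :=
  decayingSeries ((r : ℂ) / T) (n / T + stepDelta (n % T) r)
    (n / T + stepDelta (n % T) (T - r) + 1)

/-- The derivative combines the given series and the first new one; `expQuot_sub` then yields the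
second. -/
lemma expQuot_mem_zhuAnnihilator_of {n r k : ℕ} {a : ℂ} (hk : k ≠ 0)
    (h : expQuot a k ∈ zhuAnnihilator g T n r) :
    expQuot (a + 1) (k + 1) ∈ zhuAnnihilator g T n r ∧
      expQuot a (k + 1) ∈ zhuAnnihilator g T n r := by
  have hd := deriv_mem_zhuAnnihilator h
  rw [deriv_expQuot] at hd
  have h1 : expQuot (a + 1) (k + 1) ∈ zhuAnnihilator g T n r := by
    have := sub_mem (Submodule.smul_mem _ a h) hd
    rw [sub_sub_cancel] at this
    exact (Submodule.smul_mem_iff _ (by exact_mod_cast hk)).1 this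
  refine ⟨h1, ?_⟩
  have := sub_mem h1 h
  rwa [← expQuot_sub a k, sub_sub_cancel] at this

lemma diamondSeries_le {n r : ℕ} (hr : r < T) :
    diamondSeries T n r ≤ zhuAnnihilator g T n r := by
  refine Submodule.span_le.2 ?_
  rintro _ ⟨q, k, hq, hk, rfl⟩
  obtain ⟨i, rfl⟩ := Nat.exists_eq_add_of_le hq
  obtain ⟨j, rfl⟩ := Nat.exists_eq_add_of_le hk
  -- Starting from the series of `◇`, first `q` and `k` grow together (index `i`), then `k` alone
  -- (index `j`).
  have h0 : ∀ i : ℕ, expQuot (((n / T + stepDelta (n % T) r + i : ℕ) : ℂ) + (r : ℂ) / T)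
      (n / T + stepDelta (n % T) r + i + (n / T + stepDelta (n % T) (T - r) + 1)) ∈
        zhuAnnihilator g T n r := by
    intro i
    induction i with
    | zero =>
      rw [mem_zhuAnnihilator]
      intro u hu v
      convert diamond_mem_zhuO n hr hu v using 1
      rw [diamond]
      congr 2
      · push_cast; ring
      · ring
    | succ i ih =>
      convert (expQuot_mem_zhuAnnihilator_of (by lia) ih).1 using 2
      · push_cast; ring
      · ring
  induction j with
  | zero => exact h0 i
  | succ j ih => exact (expQuot_mem_zhuAnnihilator_of (by lia) (ih (by lia))).2

lemma res_mem_zhuO {n r : ℕ} (hr : r < T) {h : LaurentSeries ℂ} (hh : h ∈ diamondSeries T n r)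
    {u : V} (hu : u ∈ eigen g T r) (v : V) : res h u v ∈ zhuO g T n :=
  mem_zhuAnnihilator.1 (diamondSeries_le hr hh) u hu v

lemma diamondSeries_zero (hT : 0 < T) (n : ℕ) :
    diamondSeries T n 0 = decayingSeries 0 (n / T + 1) (n / T + 1) := by
  have h : n % T < T := Nat.mod_lt n hT
  simp [diamondSeries, stepDelta, not_le.2 h]

lemma res_mem_zhuO_of_eigen_zero (hT : 0 < T) {n : ℕ} {h : LaurentSeries ℂ}
    (hh : h ∈ decayingSeries 0 (n / T + 1) (n / T + 1)) {u : V} (hu : u ∈ eigen g T 0) (v : V) :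
    res h u v ∈ zhuO g T n :=
  res_mem_zhuO hT (by rwa [diamondSeries_zero hT]) hu v

lemma res_regular_mem_zhuO (hT : 0 < T) {n : ℕ} {f : LaurentSeries ℂ} (hf : f ∈ regularSeries)
    (hf' : deriv f ∈ decayingSeries 0 (n / T + 1) (n / T + 1)) {u : V} (hu : u ∈ eigen g T 0)
    {x : V} (hx : x ∈ zhuO g T n) : res f u x ∈ zhuO g T n := by
  rw [← resHom_apply]
  induction hx using Submodule.span_induction with
  | mem x hx =>
    rw [resHom_apply]
    rcases hx with ⟨r, hr, v, hv, w, rfl⟩ | ⟨v, rfl⟩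
    · obtain ⟨J, hJ⟩ := exists_mode_eq_zero u v
      have hmem : expQuot ((stepDelta (n % T) r : ℂ) + ((n / T : ℕ) : ℂ) + (r : ℂ) / T)
          (2 * (n / T) + stepDelta (n % T) r + stepDelta (n % T) (T - r) + 1) ∈
          diamondSeries T n r := by
        rw [add_comm (stepDelta (n % T) r : ℂ), ← Nat.cast_add]
        exact expQuot_mem_decayingSeries _ le_rfl (by lia)
      -- The commutator terms have kernels `f ^ (j) h`, regular times decaying, and `u_j v` stays in
      -- `V ^ r`.
      rw [diamond, ← sub_add_cancel (res f u _) (res _ v (res f u w)), res_comm u v w f _ hJ]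
      refine add_mem (sum_mem fun j _ => ?_) (res_mem_zhuO hr hmem hv _)
      exact res_mem_zhuO hr (mul_mem_decayingSeries
        (hasseDeriv_mem_of_deriv_mem (fun _ => deriv_mem_regularSeries) hf j) hmem)
        (mode_mem_eigen hu hv j) w
    -- Moving `𝒟` off `v` leaves an element of `𝒟 V` and the residue with kernel `f'`.
    · have h := opD_res f u v
      rw [res_opD_left] at h
      rw [← sub_eq_iff_eq_add'.2 h, sub_neg_eq_add]
      exact add_mem (opD_mem_zhuO n _) (res_mem_zhuO_of_eigen_zero hT hf' hu v)
  | zero => rw [map_zero]; exact zero_mem _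
  | add x y _ _ hx hy => rw [map_add]; exact add_mem hx hy
  | smul c x _ hx => rw [map_smul]; exact Submodule.smul_mem _ _ hx

/-- Skew-symmetry turns this into the action of `v` on `x` with kernel `f(-x)`. -/
lemma res_left_mem_zhuO (hT : 0 < T) {n : ℕ} {f : LaurentSeries ℂ} (hf : f ∈ regularSeries)
    (hf' : deriv f ∈ decayingSeries 0 (n / T + 1) (n / T + 1)) {x : V} (hx : x ∈ zhuO g T n)
    {v : V} (hv : v ∈ eigen g T 0) : res f x v ∈ zhuO g T n := by
  have h1 := range_opDHom_le_zhuO (g := g) (T := T) n (res_skew f x v)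
  refine (add_mem_cancel_right (res_regular_mem_zhuO hT (negX_mem_regularSeries hf) ?_ hv hx)).1 h1
  rw [deriv_negX]
  exact neg_mem (negX_mem_decayingSeries hf')

lemma res_assoc_mem_zhuO (hT : 0 < T) (n : ℕ) {u v : V} (hu : u ∈ eigen g T 0)
    (hv : v ∈ eigen g T 0) (w : V) :
    res (bulletSeries (n / T)) (res (bulletSeries (n / T)) u v) w -
      res (bulletSeries (n / T)) u (res (bulletSeries (n / T)) v w) ∈ zhuO g T n := by
  obtain ⟨N, hN⟩ := exists_vanishesBelow (bulletSeries (n / T))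
  obtain ⟨J, hJ⟩ := exists_mode_eq_zero v w
  obtain ⟨J', hJ'⟩ := exists_mode_eq_zero u w
  have h := res_iterate (J := J + N.natAbs + 1) (J' := J') u v w (bulletSeries (n / T))
    (bulletSeries (n / T)) hN (fun j hj => hJ j (by lia)) hJ'
  rw [Finset.sum_range_succ', pow_zero, one_smul, LaurentSeries.hasseDeriv_zero, Nat.cast_zero,
    LinearMap.id_apply, single_zero_one, one_mul] at h
  -- The term `j = 0` of the first sum cancels; derivatives of `B` of positive order remain there.
  rw [h, sub_right_comm, add_sub_cancel_right]
  refine sub_mem (sum_mem fun j _ => Submodule.smul_mem _ _ ?_) (sum_mem fun j _ => ?_)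
  · exact res_mem_zhuO_of_eigen_zero hT (hasseDeriv_succ_mem (fun _ => deriv_mem_decayingSeries)
      (deriv_bulletSeries_mem _) j) hu _
  · refine res_mem_zhuO_of_eigen_zero hT ?_ hv _
    rcases j with _ | j
    · rw [LaurentSeries.hasseDeriv_zero]
      exact negX_bulletSeries_mul_mem _
    · rw [mul_comm]
      exact mul_mem_decayingSeries (bulletSeries_mem_regularSeries _) (negX_mem_decayingSeries
        (hasseDeriv_succ_mem (fun _ => deriv_mem_decayingSeries) (deriv_bulletSeries_mem _) j))

/-- For `0 < r < T` the space `V ^ r` lies in `Õ_{g, n}(V)`. -/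
lemma eigen_le_zhuO {n r : ℕ} (h0 : 0 < r) (hr : r < T) : eigen g T r ≤ zhuO g T n := by
  intro v hv
  -- Modulo `𝒟 V`, `v ◇ 𝟏` is a residue times `v`. This residue is nonzero because the exponent has
  -- fractional part `r / T`.
  have h1 := diamond_mem_zhuO n hr hv vac
  have h2 := range_opDHom_le_zhuO (g := g) (T := T) n (res_vac_right
    (expQuot ((stepDelta (n % T) r : ℂ) + ((n / T : ℕ) : ℂ) + (r : ℂ) / T)
      (2 * (n / T) + stepDelta (n % T) r + stepDelta (n % T) (T - r) + 1)) v)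
  have h3 := sub_mem h1 h2
  rw [diamond, sub_sub_cancel] at h3
  refine (Submodule.smul_mem_iff _ (residue_expQuot_ne_zero (fun m hm => ?_) _)).1 h3
  have hT : (T : ℂ) ≠ 0 := by exact_mod_cast (h0.trans hr).ne'
  field_simp at hm
  have hm' : (stepDelta (n % T) r + n / T) * T + r = T * m := by
    have : (((stepDelta (n % T) r + n / T) * T + r : ℕ) : ℂ) = ((T * m : ℕ) : ℂ) := by
      push_cast
      linear_combination hm
    exact_mod_cast this
  have := congrArg (· % T) hm'
  simp [Nat.add_mod, Nat.mod_eq_of_lt hr] at this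
  lia

end ZhuIdeal

/-! ### Projections onto eigenspaces, and `•` modulo `Õ` on all of `V`. -/

section Projection

variable {V : Type u} [AddCommGroup V] [Module ℂ V] [VertexAlgebra V] {g : Aut V} {T : ℕ}

/-- The projection of `V` onto `V ^ r` along the other eigenspaces. -/
def projEigen (g : Aut V) (T r : ℕ) : V →ₗ[ℂ] V :=
  (T : ℂ)⁻¹ • ∑ j ∈ Finset.range T, ((omegaT T)⁻¹ ^ (r * j)) •
    ((g.toLinearEquiv ^ j : V ≃ₗ[ℂ] V) : V →ₗ[ℂ] V)

lemma projEigen_apply (r : ℕ) (v : V) : projEigen g T r v =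
    (T : ℂ)⁻¹ • ∑ j ∈ Finset.range T, ((omegaT T)⁻¹ ^ (r * j)) • (g.toLinearEquiv ^ j) v := by
  simp [projEigen]

lemma projEigen_zero (v : V) : projEigen g T 0 v = projZero g T v := by
  simp [projEigen_apply, projZero]

lemma projEigen_mem (hT : 0 < T) (hg : orderOf g.toLinearEquiv = T) (r : ℕ) (v : V) :
    projEigen g T r v ∈ eigen g T r := by
  obtain ⟨S, rfl⟩ := Nat.exists_eq_add_of_le' hT
  have hω : omegaT (S + 1) ^ (S + 1) = 1 := (omegaT_isPrimitiveRoot hT).pow_eq_one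
  have hω0 := omegaT_ne_zero (S + 1)
  have hgT : g.toLinearEquiv ^ (S + 1) = 1 := by rw [← hg, pow_orderOf_eq_one]
  rw [mem_eigen, projEigen_apply, map_smul, map_sum, smul_comm]
  congr 1
  -- Applying `g` shifts the sum cyclically: the last term on one side is the first on the other, as
  -- `g ^ T = 1` and `ω_T ^ T = 1`.
  rw [Finset.smul_sum, Finset.sum_range_succ, Finset.sum_range_succ' (fun j => _ • _ • _)]
  congr 1
  · refine Finset.sum_congr rfl fun j _ => ?_
    rw [map_smul, smul_smul, pow_succ' g.toLinearEquiv, mul_add, _root_.pow_add, mul_one, mul_left_comm,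
      ← mul_pow, mul_inv_cancel₀ hω0, one_pow, mul_one]
    rfl
  · rw [map_smul, smul_smul, mul_zero, pow_zero, pow_zero, mul_one]
    have h1 : g.toLinearEquiv ((g.toLinearEquiv ^ S) v) = v := by
      have := congrArg (fun e : V ≃ₗ[ℂ] V => e v) hgT
      rw [pow_succ'] at this
      exact this
    rw [h1]
    have h2 : (omegaT (S + 1))⁻¹ ^ (r * S) = omegaT (S + 1) ^ r := by
      rw [inv_pow, inv_eq_iff_eq_inv, ← mul_eq_one_iff_eq_inv₀ (pow_ne_zero _ hω0), ← _root_.pow_add,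
        show r * S + r = (S + 1) * r by ring, pow_mul, hω, one_pow]
    rw [h2]
    rfl

lemma sum_projEigen (hT : 0 < T) (v : V) : ∑ r ∈ Finset.range T, projEigen g T r v = v := by
  have hT' : (T : ℂ) ≠ 0 := by exact_mod_cast hT.ne'
  simp only [projEigen_apply]
  rw [← Finset.smul_sum, Finset.sum_comm]
  simp only [← Finset.sum_smul]
  -- Orthogonality of roots of unity: summing over `r` kills every `j ≠ 0`.
  rw [Finset.sum_eq_single_of_mem 0 (Finset.mem_range.2 hT)]
  · simp [smul_smul, hT']
  · intro j hj hj0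
    have hp := (omegaT_isPrimitiveRoot hT).inv
    have h1 : (omegaT T)⁻¹ ^ j ≠ 1 := hp.pow_ne_one_of_pos_of_lt hj0 (Finset.mem_range.1 hj)
    have h2 : ∑ r ∈ Finset.range T, (omegaT T)⁻¹ ^ (r * j) = 0 := by
      simp only [mul_comm _ j, pow_mul]
      rw [geom_sum_eq h1, ← pow_mul, mul_comm, pow_mul, hp.pow_eq_one, one_pow, sub_self, zero_div]
    rw [h2, zero_smul]

lemma projZero_sub_mem_zhuO (hT : 0 < T) (hg : orderOf g.toLinearEquiv = T) (n : ℕ) (v : V) :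
    v - projZero g T v ∈ zhuO g T n := by
  obtain ⟨S, rfl⟩ := Nat.exists_eq_add_of_le' hT
  have h := sum_projEigen (g := g) hT v
  rw [Finset.sum_range_succ', projEigen_zero] at h
  rw [← eq_sub_of_add_eq h]
  refine sum_mem fun r hr => ?_
  have := Finset.mem_range.1 hr
  exact eigen_le_zhuO (r := r + 1) (by lia) (by lia) (projEigen_mem hT hg _ v)

lemma projZero_mem (hT : 0 < T) (hg : orderOf g.toLinearEquiv = T) (v : V) :
    projZero g T v ∈ eigen g T 0 := by
  rw [← projEigen_zero]
  exact projEigen_mem hT hg 0 v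

lemma projZero_mem_zhuO (hT : 0 < T) (hg : orderOf g.toLinearEquiv = T) {n : ℕ} {v : V}
    (hv : v ∈ zhuO g T n) : projZero g T v ∈ zhuO g T n := by
  have := sub_mem hv (projZero_sub_mem_zhuO hT hg n v)
  rwa [sub_sub_cancel] at this

lemma pow_apply_of_mem_eigen_zero {u : V} (hu : u ∈ eigen g T 0) (j : ℕ) :
    (g.toLinearEquiv ^ j) u = u := by
  rw [mem_eigen, pow_zero, one_smul] at hu
  induction j with
  | zero => rfl
  | succ j ih => rw [pow_succ']; exact (congrArg g.toLinearEquiv ih).trans hu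

lemma projZero_of_mem (hT : 0 < T) {u : V} (hu : u ∈ eigen g T 0) : projZero g T u = u := by
  have hT' : (T : ℂ) ≠ 0 := by exact_mod_cast hT.ne'
  simp only [projZero, pow_apply_of_mem_eigen_zero hu, Finset.sum_const, Finset.card_range]
  rw [← Nat.cast_smul_eq_nsmul ℂ, smul_smul, inv_mul_cancel₀ hT', one_smul]

lemma pow_map_res (f : LaurentSeries ℂ) (u v : V) (j : ℕ) :
    (g.toLinearEquiv ^ j) (res f u v) =
      res f ((g.toLinearEquiv ^ j) u) ((g.toLinearEquiv ^ j) v) := by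
  induction j with
  | zero => rfl
  | succ j ih =>
    rw [pow_succ']
    exact (congrArg g.toLinearEquiv ih).trans (map_res f _ _)

lemma projZero_res (f : LaurentSeries ℂ) {u : V} (hu : u ∈ eigen g T 0) (v : V) :
    projZero g T (res f u v) = res f u (projZero g T v) := by
  simp only [projZero, pow_map_res, pow_apply_of_mem_eigen_zero hu]
  rw [← resHom_apply, map_smul, map_sum]
  rfl

lemma vac_mem_eigen : (vac : V) ∈ eigen g T 0 := by
  rw [mem_eigen, g.map_vac, pow_zero, one_smul]

lemma bullet_eq (n : ℕ) (u v : V) :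
    bullet g T n u v = res (bulletSeries (n / T)) (projZero g T u) v := by
  rw [← resSeries_apply, bulletSeries, map_sum]
  simp only [map_smul]
  rfl

/-- The product `•` as a bilinear map. -/
def bulletHom (g : Aut V) (T n : ℕ) : V →ₗ[ℂ] V →ₗ[ℂ] V :=
  resHom (bulletSeries (n / T)) ∘ₗ projEigen g T 0

lemma bulletHom_apply (n : ℕ) (u v : V) : bulletHom g T n u v = bullet g T n u v := by
  rw [bullet_eq, ← projEigen_zero]
  rfl

lemma bullet_mem_right (hT : 0 < T) (hg : orderOf g.toLinearEquiv = T) {n : ℕ} (u : V) {v : V}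
    (hv : v ∈ zhuO g T n) : bullet g T n u v ∈ zhuO g T n := by
  rw [bullet_eq]
  exact res_regular_mem_zhuO hT (bulletSeries_mem_regularSeries _) (deriv_bulletSeries_mem _)
    (projZero_mem hT hg u) hv

lemma bullet_mem_left (hT : 0 < T) (hg : orderOf g.toLinearEquiv = T) {n : ℕ} {u : V} (v : V)
    (hu : u ∈ zhuO g T n) : bullet g T n u v ∈ zhuO g T n := by
  -- This replaces `v` by its projection, as skew-symmetry is only usable for `v` in `V ^ 0`.
  have h1 := bullet_mem_right hT hg u (projZero_sub_mem_zhuO hT hg n v)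
  rw [← bulletHom_apply, map_sub, bulletHom_apply, bulletHom_apply] at h1
  refine (Submodule.sub_mem_iff_left _ ?_).1 h1
  rw [bullet_eq]
  exact res_left_mem_zhuO hT (bulletSeries_mem_regularSeries _) (deriv_bulletSeries_mem _)
    (projZero_mem_zhuO hT hg hu) (projZero_mem hT hg v)

lemma bullet_assoc_mem (hT : 0 < T) (hg : orderOf g.toLinearEquiv = T) (n : ℕ) (u v w : V) :
    bullet g T n (bullet g T n u v) w - bullet g T n u (bullet g T n v w) ∈ zhuO g T n := by
  rw [bullet_eq n u v, bullet_eq, bullet_eq, bullet_eq, projZero_res _ (projZero_mem hT hg u)]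
  exact res_assoc_mem_zhuO hT n (projZero_mem hT hg u) (projZero_mem hT hg v) w

lemma vac_bullet (hT : 0 < T) (n : ℕ) (v : V) : bullet g T n vac v = v := by
  rw [bullet_eq, projZero_of_mem hT vac_mem_eigen, res_vac_left, residue_bulletSeries, one_smul]

lemma bullet_vac_mem (hT : 0 < T) (hg : orderOf g.toLinearEquiv = T) (n : ℕ) (v : V) :
    bullet g T n v vac - v ∈ zhuO g T n := by
  have h1 := range_opDHom_le_zhuO (g := g) (T := T) n
    (res_vac_right (bulletSeries (n / T)) (projZero g T v))
  rw [residue_bulletSeries, one_smul, ← bullet_eq] at h1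
  have h2 := sub_mem h1 (projZero_sub_mem_zhuO hT hg n v)
  rwa [sub_sub, add_sub_cancel] at h2

end Projection

/-! ### Laurent polynomials in `t` and the substitution `t = e ^ (x / T)`. -/

section LaurentPolynomials

open scoped LaurentPolynomial

/-- The substitution `t ↦ e ^ (x / T)` in Laurent polynomials in `t`. -/
def evalExp (T : ℕ) : ℂ[T;T⁻¹] →+* LaurentSeries ℂ :=
  AddMonoidAlgebra.liftNCRingHom (HahnSeries.C : ℂ →+* LaurentSeries ℂ)
    { toFun := fun a : Multiplicative ℤ => expo ((a.toAdd : ℂ) / T)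
      map_one' := by simp only [toAdd_one, Int.cast_zero, zero_div]; exact expo_zero
      map_mul' := fun a b => by rw [expo_mul, toAdd_mul, Int.cast_add, add_div] }
    fun _ _ => Commute.all _ _

lemma evalExp_single (T : ℕ) (a : ℤ) (c : ℂ) :
    evalExp T (AddMonoidAlgebra.single a c) = c • expo ((a : ℂ) / T) := by
  rw [← C_mul_eq_smul]
  exact AddMonoidAlgebra.liftNCRingHom_single _ _ _ _ _

lemma evalExp_T (T : ℕ) (a : ℤ) :
    evalExp T (LaurentPolynomial.T a) = expo ((a : ℂ) / T) := by
  rw [LaurentPolynomial.T, evalExp_single, ← C_mul_eq_smul, map_one, one_mul]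

lemma evalExp_eq_sum (T : ℕ) (p : ℂ[T;T⁻¹]) :
    evalExp T p = ∑ a ∈ p.coeff.support, p.coeff a • expo ((a : ℂ) / T) := by
  conv_lhs => rw [← AddMonoidAlgebra.sum_coeff_single p]
  rw [Finsupp.sum, map_sum]
  simp only [evalExp_single]

lemma expo_ne_zero (a : ℂ) : expo a ≠ 0 := by
  intro h
  have := congrArg (fun f => f.coeff ((0 : ℕ) : ℤ)) h
  simp only [coeff_expo] at this
  simp at this

lemma evalExp_eq_zero {T : ℕ} (hT : 0 < T) {p : ℂ[T;T⁻¹]} (h : evalExp T p = 0) : p = 0 := by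
  have hT' : (T : ℂ) ≠ 0 := by exact_mod_cast hT.ne'
  -- The exponentials are eigenvectors of `d/dx` with distinct eigenvalues.
  have hli : LinearIndependent ℂ fun a : ℤ => expo ((a : ℂ) / T) := by
    refine Module.End.eigenvectors_linearIndependent' (deriv : Module.End ℂ (LaurentSeries ℂ))
      (fun a : ℤ => (a : ℂ) / T) (fun a b hab => ?_) _ fun a => ⟨?_, expo_ne_zero _⟩
    · have : (a : ℂ) = b := by simpa [hT'] using hab
      exact_mod_cast this
    · rw [Module.End.mem_eigenspace_iff]
      exact deriv_expo _
  rw [evalExp_eq_sum] at h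
  rw [linearIndependent_iff'] at hli
  ext a
  by_cases ha : a ∈ p.coeff.support
  · exact hli _ _ h a ha
  · exact Finsupp.notMem_support_iff.1 ha

lemma evalExp_T_sub_one {T : ℕ} (hT : 0 < T) :
    evalExp T (LaurentPolynomial.T (T : ℤ) - 1) = expSubOne := by
  have hT' : (T : ℂ) ≠ 0 := by exact_mod_cast hT.ne'
  rw [map_sub, map_one, evalExp_T, Int.cast_natCast, div_self hT', expSubOne_eq]

lemma negX_evalExp (T : ℕ) (p : ℂ[T;T⁻¹]) :
    negX (evalExp T p) = evalExp T (LaurentPolynomial.invert p) := by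
  induction p using LaurentPolynomial.induction_on' with
  | add p q hp hq => rw [map_add, map_add, map_add, map_add, hp, hq]
  | C_mul_T a c =>
    rw [map_mul (LaurentPolynomial.invert), LaurentPolynomial.invert_C, LaurentPolynomial.invert_T,
      ← LaurentPolynomial.single_eq_C_mul_T, ← LaurentPolynomial.single_eq_C_mul_T, evalExp_single,
      evalExp_single, negX_smul, negX_expo, Int.cast_neg, neg_div]

lemma coeff_T_mul (m a : ℤ) (p : ℂ[T;T⁻¹]) :
    (LaurentPolynomial.T m * p).coeff a = p.coeff (a - m) := by
  rw [LaurentPolynomial.T, AddMonoidAlgebra.coeff_single_mul_apply, one_mul, neg_add_eq_sub]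

lemma coeff_sub_one_pow_mul (d : ℤ) (k : ℕ) (p : ℂ[T;T⁻¹]) (a : ℤ) :
    ((LaurentPolynomial.T d - 1) ^ k * p).coeff a =
      ∑ i ∈ Finset.range (k + 1), ((-1 : ℂ) ^ i * (k.choose i : ℂ)) *
        p.coeff (a - d * ((k : ℤ) - i)) := by
  rw [sub_eq_neg_add, add_pow, Finset.sum_mul, AddMonoidAlgebra.coeff_sum, Finsupp.finsetSum_apply]
  refine Finset.sum_congr rfl fun i hi => ?_
  have hik : i ≤ k := by simpa [Nat.lt_succ_iff] using hi
  have : (-1 : ℂ[T;T⁻¹]) ^ i * LaurentPolynomial.T d ^ (k - i) * (k.choose i : ℂ[T;T⁻¹]) * p =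
      ((-1 : ℂ) ^ i * (k.choose i : ℂ)) • (LaurentPolynomial.T (((k : ℤ) - i) * d) * p) := by
    rw [LaurentPolynomial.T_pow, LaurentPolynomial.smul_eq_C_mul, map_mul, map_pow, map_neg,
      map_one, map_natCast, Nat.cast_sub hik]
    ring
  rw [this, AddMonoidAlgebra.coeff_smul_apply, coeff_T_mul, smul_eq_mul, mul_comm d]

/-- The coefficients of the Laurent polynomial `p` in degrees less than `N` vanish. -/
def PolyVanishesBelow (N : ℤ) (p : ℂ[T;T⁻¹]) : Prop := ∀ a < N, p.coeff a = 0

lemma PolyVanishesBelow.sub_one_pow_mul {N d : ℤ} (hd : 0 ≤ d) {p : ℂ[T;T⁻¹]}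
    (hp : PolyVanishesBelow N p) (k : ℕ) :
    PolyVanishesBelow N ((LaurentPolynomial.T d - 1) ^ k * p) := by
  intro a ha
  rw [coeff_sub_one_pow_mul]
  refine Finset.sum_eq_zero fun i hi => ?_
  have hik : i ≤ k := by simpa [Nat.lt_succ_iff] using hi
  have : 0 ≤ d * ((k : ℤ) - i) := mul_nonneg hd (by lia)
  rw [hp _ (by lia), mul_zero]

/-- Below `N` each coefficient equals the one `d` degrees lower, and finite support forces zero. -/
lemma PolyVanishesBelow.of_one_sub_mul {N d : ℤ} (hd : 0 < d) {p : ℂ[T;T⁻¹]}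
    (hp : PolyVanishesBelow N ((1 - LaurentPolynomial.T d) * p)) : PolyVanishesBelow N p := by
  have hrec : ∀ a < N, p.coeff a = p.coeff (a - d) := by
    intro a ha
    have := hp a ha
    rw [sub_mul, one_mul, AddMonoidAlgebra.coeff_sub, Finsupp.sub_apply, coeff_T_mul] at this
    exact sub_eq_zero.1 this
  obtain ⟨B, hB⟩ : BddBelow (p.coeff.support : Set ℤ) := p.coeff.support.bddBelow
  intro a ha
  have key : ∀ m : ℕ, p.coeff a = p.coeff (a - m * d) := by
    intro m
    induction m with
    | zero => simp
    | succ m ih =>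
      rw [ih, hrec _ (by nlinarith)]
      congr 1
      push_cast
      ring
  rw [key (a - B + 1).toNat]
  by_contra h
  have h1 := hB (Finset.mem_coe.2 (Finsupp.mem_support_iff.2 h))
  have h2 := Int.self_le_toNat (a - B + 1)
  nlinarith [Int.natCast_nonneg (a - B + 1).toNat]

lemma PolyVanishesBelow.of_one_sub_pow_mul {N d : ℤ} (hd : 0 < d) {p : ℂ[T;T⁻¹]} (k : ℕ)
    (hp : PolyVanishesBelow N ((1 - LaurentPolynomial.T d) ^ k * p)) : PolyVanishesBelow N p := by
  induction k with
  | zero => simpa using hp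
  | succ k ih =>
    rw [pow_succ', mul_assoc] at hp
    exact ih (hp.of_one_sub_mul hd)

/-- If the function `S` vanishes in large degrees and `(t ^ d - 1) ^ k S = 0`, then `S = 0`. -/
lemma eq_zero_of_sub_one_pow_mul {d B : ℤ} (hd : 0 < d) {k : ℕ} {S : ℤ → ℂ}
    (hS : ∀ a, B < a → S a = 0)
    (h : ∀ a, ∑ i ∈ Finset.range (k + 1), ((-1 : ℂ) ^ i * (k.choose i : ℂ)) *
        S (a - d * ((k : ℤ) - i)) = 0) (a : ℤ) : S a = 0 := by
  have key : ∀ m : ℕ, ∀ a, B - m < a → S a = 0 := by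
    intro m
    induction m with
    | zero => simpa using hS
    | succ m ih =>
      intro a ha
      -- In the relation at this degree, `i = 0` gives `S a` and `i ≥ 1` gives values at `a + d i`,
      -- zero by induction.
      have h1 := h (a + d * k)
      rw [Finset.sum_range_succ', Finset.sum_eq_zero fun i _ => ?_] at h1
      · simpa using h1
      · rw [ih _ ?_, mul_zero]
        have : a + d * k - d * ((k : ℤ) - (i + 1 : ℕ)) = a + d * (i + 1) := by push_cast; ring
        rw [this]
        push_cast at ha
        nlinarith
  exact key (B - a + 1).toNat a (by lia)

end LaurentPolynomials

/-! ### Two-point functions of twisted modules. -/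

namespace TwistedPhiModule

open scoped LaurentPolynomial

variable {V : Type u} [AddCommGroup V] [Module ℂ V] [VertexAlgebra V] {g : Aut V} {T : ℕ}
  (M : TwistedPhiModule.{u, w} g T)

lemma o_vac (a : ℤ) (x : M.carrier) : M.o a vac x = if a = 0 then x else 0 := M.vac_coeff a x

lemma o_add (a : ℤ) (u v : V) : M.o a (u + v) = M.o a u + M.o a v := by
  simp [o]

lemma o_smul (a : ℤ) (c : ℂ) (v : V) : M.o a (c • v) = c • M.o a v := by
  simp [o]

/-- The operator `o_a(v)` as a linear map in `v`. -/
def oHom (a : ℤ) (x : M.carrier) : V →ₗ[ℂ] M.carrier where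
  toFun v := M.o a v x
  map_add' u v := by rw [o_add, LinearMap.add_apply]
  map_smul' c v := by rw [o_smul, LinearMap.smul_apply, RingHom.id_apply]

lemma oHom_apply (a : ℤ) (x : M.carrier) (v : V) : M.oHom a x v = M.o a v x := rfl

lemma mem_Omega {n : ℕ} {x : M.carrier} :
    x ∈ M.Omega n ↔ ∀ (v : V) (a : ℤ), a < -(n : ℤ) → M.o a v x = 0 := by
  simp [Omega, Submodule.mem_iInf]

/-- If `o_a(v) x ≠ 0`, the twist condition and the eigenvalue of `v` give `ω_T ^ (a + r) = 1`. -/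
lemma o_eq_zero_of_eigen (hT : 0 < T) {r : ℕ} {v : V} (hv : v ∈ eigen g T r) {a : ℤ}
    (ha : ¬ (T : ℤ) ∣ a + r) (x : M.carrier) : M.o a v x = 0 := by
  have hω0 := omegaT_ne_zero T
  have h : M.o a (g.toLinearEquiv v) x = (omegaT T)⁻¹ ^ a • M.o a v x := M.twist v a x
  rw [mem_eigen.1 hv, o_smul, LinearMap.smul_apply] at h
  by_contra hne
  have h1 : omegaT T ^ r = (omegaT T)⁻¹ ^ a := smul_left_injective ℂ hne h
  refine ha (((omegaT_isPrimitiveRoot hT).zpow_eq_one_iff_dvd _).1 ?_)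
  rw [zpow_add₀ hω0, zpow_natCast, h1, inv_zpow, mul_inv_cancel₀ (zpow_ne_zero _ hω0)]

section Correlators

variable (φ : Module.Dual ℂ M.carrier) (x : M.carrier)

/-- The series `⟨φ, o_c(Y(u, z) v) x⟩` in `z`. -/
def correlator (c : ℤ) (u v : V) : LaurentSeries ℂ :=
  HahnSeries.ofSuppBddBelow (fun j => φ (M.o c (mode u (-j - 1) v) x)) (by
    obtain ⟨N, hN⟩ := exists_mode_eq_zero u v
    refine ⟨-N - 1, fun j hj => ?_⟩
    by_contra h
    refine hj ?_
    change φ (M.oHom c x (mode u (-j - 1) v)) = 0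
    rw [hN _ (by lia), map_zero, map_zero])

lemma coeff_correlator (c : ℤ) (u v : V) (j : ℤ) :
    (M.correlator φ x c u v).coeff j = φ (M.o c (mode u (-j - 1) v) x) := rfl

lemma apply_o_res (c : ℤ) (f : LaurentSeries ℂ) (u v : V) :
    φ (M.o c (res f u v) x) = residue (f * M.correlator φ x c u v) := by
  have h : φ (M.o c (res f u v) x) = (φ ∘ₗ M.oHom c x) (res f u v) := rfl
  rw [h, residue, coeff_mul_finsum, res, map_finsum _ (support_res_finite f u v)]
  refine finsum_congr fun j => ?_
  rw [map_smul, coeff_correlator, show -(-1 - j) - 1 = j by ring]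
  rfl

/-- The matrix coefficient `⟨φ, o_a(u) o_{c - a}(v) x⟩`. -/
def twoPoint (c : ℤ) (u v : V) (a : ℤ) : ℂ := φ (M.o a u (M.o (c - a) v x))

lemma ofPowerSeries_mul_coeff (p : PowerSeries ℂ) (f : LaurentSeries ℂ) (j : ℤ) :
    (HahnSeries.ofPowerSeries ℤ ℂ p * f).coeff j =
      ∑ᶠ i : ℕ, PowerSeries.coeff i p * f.coeff (j - i) := by
  rw [coeff_mul_finsum]
  have hsupp : (Function.support fun i : ℤ =>
      (HahnSeries.ofPowerSeries ℤ ℂ p).coeff i * f.coeff (j - i)) ⊆ Set.range ((↑) : ℕ → ℤ) := by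
    intro i hi
    rcases le_or_gt 0 i with h | h
    · exact ⟨i.toNat, Int.toNat_of_nonneg h⟩
    · exact absurd (by simp only [coeff_ofPowerSeries_of_neg p h, zero_mul]) hi
  rw [← finsum_mem_univ, finsum_mem_inter_support_eq _ Set.univ (Set.range ((↑) : ℕ → ℤ))
    (by rw [Set.univ_inter, Set.inter_eq_right.2 hsupp]), finsum_mem_range Nat.cast_injective]
  refine finsum_congr fun i => ?_
  rw [LaurentSeries.coeff_coe_powerSeries]

/-- Associativity of a twisted `φ`-coordinated module, evaluated at a linear functional. -/
lemma exists_evalExp_eq (u v : V) : ∃ k : ℕ, ∀ (φ : Module.Dual ℂ M.carrier) (x : M.carrier)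
    (c : ℤ), ∃ p : ℂ[T;T⁻¹],
      (∀ a, p.coeff a = ∑ i ∈ Finset.range (k + 1), ((-1 : ℂ) ^ i * (k.choose i : ℂ)) *
        M.twoPoint φ x c u v (a - T * ((k : ℤ) - i))) ∧
      evalExp T p = expSubOne ^ k * M.correlator φ x c u v := by
  obtain ⟨k, hk⟩ := M.assoc u v
  refine ⟨k, fun φ x c => ?_⟩
  obtain ⟨A, hA, ⟨N, hN⟩, h⟩ := hk x
  -- Both indices of `A` are bounded below and their sum is fixed.
  have hfin : (Function.support fun a => φ (A a (c + T * k - a))).Finite := by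
    refine (Set.finite_Icc N (c + T * k - N)).subset fun a ha => ?_
    by_contra hcon
    refine ha ?_
    change φ (A a (c + T * k - a)) = 0
    rw [hN _ _ (by simp only [Set.mem_Icc] at hcon; lia), map_zero]
  refine ⟨AddMonoidAlgebra.ofCoeff (Finsupp.onFinset hfin.toFinset
    (fun a => φ (A a (c + T * k - a))) fun a ha => by simpa using ha), fun a => ?_, ?_⟩
  · change φ (A a (c + T * k - a)) = _
    rw [hA, map_sum]
    refine Finset.sum_congr rfl fun i _ => ?_
    rw [map_smul, smul_eq_mul, twoPoint,
      show c - (a - T * ((k : ℤ) - i)) = c + T * k - a - T * i by ring]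
    rfl
  · ext j
    -- The shift by `T k` absorbs the factor `x₂ ^ k`.
    have hj := congrArg φ (h (c + T * k) j)
    rw [show c + T * (k : ℤ) - T * k = c by ring] at hj
    have hL : (expSubOne ^ k * M.correlator φ x c u v).coeff j =
        φ (∑ᶠ i : ℕ, PowerSeries.coeff i ((PowerSeries.exp ℂ - 1) ^ k) •
        HVertexOperator.coeff (M.YW (mode u ((i : ℤ) - j - 1) v)) c x) := by
      rw [expSubOne, ← map_pow, ofPowerSeries_mul_coeff, map_finsum]
      · refine finsum_congr fun i => ?_
        rw [coeff_correlator, map_smul, smul_eq_mul, neg_sub]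
        rfl
      · obtain ⟨N', hN'⟩ := exists_mode_eq_zero u v
        refine (Set.finite_Iio (N' + j.natAbs + 1)).subset fun i hi => ?_
        by_contra hcon
        refine hi ?_
        rw [Set.mem_Iio, not_lt] at hcon
        change _ • M.oHom c x (mode u (i - j - 1) v) = 0
        rw [hN' _ (by lia), map_zero, smul_zero]
    rw [hL, hj, evalExp_eq_sum, HahnSeries.coeff_sum]
    simp only [HahnSeries.coeff_smul, smul_eq_mul]
    split_ifs with h0
    · lift j to ℕ using h0
      rw [Int.toNat_natCast, map_finsum]
      · rw [finsum_eq_sum_of_support_subset]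
        · refine Finset.sum_congr rfl fun a _ => ?_
          rw [coeff_expo, map_smul, smul_eq_mul, mul_comm]
          rfl
        · intro a ha
          rw [Finset.mem_coe, Finsupp.mem_support_iff]
          intro h0
          refine ha ?_
          change φ (_ • A a (c + T * k - a)) = 0
          rw [map_smul]
          change φ (A a (c + T * k - a)) = 0 at h0
          rw [h0, smul_zero]
      · refine (Set.finite_Icc N (c + T * k - N)).subset fun a ha => ?_
        by_contra hcon
        refine ha ?_
        change _ • A a (c + T * k - a) = 0
        rw [hN _ _ (by simp only [Set.mem_Icc] at hcon; lia), smul_zero]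
    · rw [map_zero]
      refine Finset.sum_eq_zero fun a _ => ?_
      rw [coeff_ofPowerSeries_of_neg _ (not_le.1 h0), mul_zero]

end Correlators

lemma eq_zero_of_dual {y : M.carrier} (h : ∀ φ : Module.Dual ℂ M.carrier, φ y = 0) : y = 0 :=
  (Module.forall_dual_apply_eq_zero_iff ℂ y).1 h

/-- `o(𝒟 v) = 0`. -/
lemma o_zero_opD (hT : 0 < T) (v : V) (x : M.carrier) : M.o 0 (opD v) x = 0 := by
  refine M.eq_zero_of_dual fun φ => ?_
  obtain ⟨k, hk⟩ := M.exists_evalExp_eq v vac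
  obtain ⟨p, hp, hp'⟩ := hk φ x 0
  -- Against the vacuum only degree zero occurs, so the correlator is constant; its coefficient of
  -- `z` is `⟨φ, o(𝒟 v) x⟩`.
  have hS : ∀ a, M.twoPoint φ x 0 v vac a =
      (LaurentPolynomial.C (φ (M.o 0 v x)) : ℂ[T;T⁻¹]).coeff a := by
    intro a
    rw [twoPoint, o_vac, LaurentPolynomial.C_apply, zero_sub]
    by_cases h : a = 0
    · subst h; simp
    · simp [h]
  have hpe : p = (LaurentPolynomial.T (T : ℤ) - 1) ^ k * LaurentPolynomial.C (φ (M.o 0 v x)) := by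
    ext a
    rw [hp, coeff_sub_one_pow_mul]
    simp only [hS]
  rw [hpe, map_mul, map_pow, evalExp_T_sub_one hT] at hp'
  have h1 := congrArg (fun f => f.coeff ((1 : ℕ) : ℤ))
    (mul_left_cancel₀ (expSubOne_pow_ne_zero k) hp')
  simp only [coeff_correlator, ← LaurentPolynomial.single_eq_C, evalExp_single,
    HahnSeries.coeff_smul, coeff_expo] at h1
  rw [opD]
  simpa using h1.symm

/-- Skew-symmetry holds modulo `𝒟 V`, which `o = o_0` annihilates. -/
lemma correlator_skew (hT : 0 < T) (φ : Module.Dual ℂ M.carrier) (x : M.carrier) (u v : V) :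
    M.correlator φ x 0 u v = negX (M.correlator φ x 0 v u) := by
  ext j
  rw [coeff_negX, coeff_correlator, coeff_correlator]
  obtain ⟨w, hw⟩ := mode_skew u v (-j - 1)
  have h : φ (M.oHom 0 x (opDHom w)) = 0 := by
    rw [oHom_apply]
    exact (congrArg φ (M.o_zero_opD hT w x)).trans (map_zero φ)
  rw [hw, map_add, map_add, map_smul, map_smul, oHom_apply, oHom_apply, smul_eq_mul] at h
  rw [eq_neg_of_add_eq_zero_left h, zpow_sub₀ (by norm_num), zpow_neg, zpow_one]
  have h2 : ((-1 : ℂ) ^ j)⁻¹ = (-1) ^ j := by rw [← inv_zpow]; norm_num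
  rw [h2]
  ring

section Omega

variable {M} {n : ℕ} {x : M.carrier}

lemma twoPoint_eq_zero (hx : x ∈ M.Omega n) (φ : Module.Dual ℂ M.carrier) {c a : ℤ}
    (ha : c + n < a) (u v : V) : M.twoPoint φ x c u v a = 0 := by
  rw [twoPoint, M.mem_Omega.1 hx v (c - a) (by lia), map_zero, map_zero]

/-- The subspace `Ω̃_n(W)` is stable under the `o(v)`. -/
lemma o_zero_mem_Omega (hT : 0 < T) (hx : x ∈ M.Omega n) (v : V) : M.o 0 v x ∈ M.Omega n := by
  rw [mem_Omega]
  intro u c hc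
  refine M.eq_zero_of_dual fun φ => ?_
  obtain ⟨k, hk⟩ := M.exists_evalExp_eq u v
  obtain ⟨p, hp, hp'⟩ := hk φ x c
  -- For `c < -n` the correlator vanishes, so `(t ^ T - 1) ^ k` annihilates the two-point function.
  -- As that is zero in large degrees, it vanishes, in particular at `a = c`.
  have h0 : M.correlator φ x c u v = 0 := by
    ext j
    rw [coeff_correlator, M.mem_Omega.1 hx _ c hc, map_zero, coeff_zero]
  rw [h0, mul_zero] at hp'
  have hp0 := evalExp_eq_zero hT hp'
  have := eq_zero_of_sub_one_pow_mul (d := T) (B := c + n) (by exact_mod_cast hT)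
    (S := M.twoPoint φ x c u v) (fun a ha => twoPoint_eq_zero hx φ ha u v)
    (fun a => by rw [← hp, hp0]; rfl) c
  rwa [twoPoint, sub_self] at this

/-- The numerator of the two-point function of `u` and `v` at a vector of `Ω̃_n(W)` vanishes
below degree `-n`. -/
lemma numerator_vanishesBelow (hT : 0 < T) (hx : x ∈ M.Omega n) (φ : Module.Dual ℂ M.carrier)
    (u v : V) {k : ℕ} {p : ℂ[T;T⁻¹]}
    (hp : evalExp T p = expSubOne ^ k * M.correlator φ x 0 u v) :
    PolyVanishesBelow (-(n : ℤ)) p := by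
  have hT' : (0 : ℤ) < T := by exact_mod_cast hT
  -- The numerator for the exchanged pair has degree at most `n + T k'`; `t ↦ t⁻¹` makes this a
  -- lower bound.
  obtain ⟨k', hk'⟩ := M.exists_evalExp_eq v u
  obtain ⟨q, hq, hq'⟩ := hk' φ x 0
  have h1 := congrArg negX hq'
  rw [map_mul, ← M.correlator_skew hT, negX_evalExp, map_pow, ← evalExp_T_sub_one hT,
    negX_evalExp, map_sub, map_one, LaurentPolynomial.invert_T] at h1
  rw [← evalExp_T_sub_one hT] at hp
  have h2 : evalExp T ((LaurentPolynomial.T (-(T : ℤ)) - 1) ^ k' * p) =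
      evalExp T ((LaurentPolynomial.T (T : ℤ) - 1) ^ k * LaurentPolynomial.invert q) := by
    rw [map_mul, map_mul, hp, h1, map_pow, map_pow]
    ring
  have h3 : (LaurentPolynomial.T (-(T : ℤ)) - 1) ^ k' * p =
      (LaurentPolynomial.T (T : ℤ) - 1) ^ k * LaurentPolynomial.invert q := by
    rw [← sub_eq_zero]
    refine evalExp_eq_zero hT ?_
    rw [map_sub, h2, sub_self]
  have h4 : PolyVanishesBelow (-(n : ℤ) - T * k') (LaurentPolynomial.invert q) := by
    intro a ha
    rw [LaurentPolynomial.invert_apply, hq]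
    refine Finset.sum_eq_zero fun i _ => ?_
    rw [twoPoint_eq_zero hx φ ?_ v u, mul_zero]
    have : (0 : ℤ) ≤ T * i := by positivity
    rw [mul_sub]
    lia
  have h5 := h4.sub_one_pow_mul hT'.le k
  rw [← h3] at h5
  -- Multiplication by `t ^ (T k')` turns the factor into `(1 - t ^ T) ^ k'`, which cancels without
  -- affecting the lower bound.
  refine PolyVanishesBelow.of_one_sub_pow_mul hT' k' fun a ha => ?_
  have h6 : (1 - LaurentPolynomial.T (T : ℤ) : ℂ[T;T⁻¹]) ^ k' * p =
      LaurentPolynomial.T (k' * T : ℤ) * ((LaurentPolynomial.T (-(T : ℤ)) - 1) ^ k' * p) := by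
    rw [← LaurentPolynomial.T_pow, ← mul_assoc, ← mul_pow, mul_sub, ← LaurentPolynomial.T_add,
      add_neg_cancel, LaurentPolynomial.T_zero, mul_one]
  rw [h6, coeff_T_mul]
  exact h5 _ (by rw [mul_comm]; lia)

/-- The two-point function of `u` and `v` at a vector of `Ω̃_n(W)` is a combination of the
`e ^ (a x / T)` with `|a| ≤ n`, whose coefficients are the `⟨φ, o_a(u) o_{-a}(v) x⟩`, and of
`e ^ (a x / T) / (e ^ x - 1) ^ k` with `-n ≤ a < T k - n`. -/
lemma correlator_decomposition (hT : 0 < T) (hx : x ∈ M.Omega n) (φ : Module.Dual ℂ M.carrier)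
    {r : ℕ} {u : V} (hu : u ∈ eigen g T r) (v : V) :
    ∃ (k : ℕ) (q : ℂ[T;T⁻¹]),
      (∀ a, q.coeff a ≠ 0 → -(n : ℤ) ≤ a ∧ a < T * k - n ∧ (T : ℤ) ∣ a + r) ∧
      M.correlator φ x 0 u v =
        ∑ a ∈ Finset.Icc (-(n : ℤ)) n, M.twoPoint φ x 0 u v a • expo ((a : ℂ) / T) +
        ∑ a ∈ q.coeff.support, q.coeff a • expQuot ((a : ℂ) / T) k := by
  obtain ⟨k, hk⟩ := M.exists_evalExp_eq u v
  obtain ⟨p, hp, hp'⟩ := hk φ x 0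
  set S := M.twoPoint φ x 0 u v with hS
  -- The part of the expansion at `t = ∞` in degrees `|a| ≤ n`. What remains has degrees below `-n`,
  -- so its numerator `q` has degrees below `T k - n`.
  let s : ℂ[T;T⁻¹] := ∑ a ∈ Finset.Icc (-(n : ℤ)) n, AddMonoidAlgebra.single a (S a)
  have hs : ∀ a, s.coeff a = if -(n : ℤ) ≤ a ∧ a ≤ n then S a else 0 := by
    intro a
    simp only [s, AddMonoidAlgebra.coeff_sum, Finsupp.finsetSum_apply,
      AddMonoidAlgebra.coeff_single, Finsupp.single_apply, Finset.sum_ite_eq', Finset.mem_Icc]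
  have hsS : ∀ a, -(n : ℤ) ≤ a → s.coeff a = S a := by
    intro a ha
    rw [hs]
    split_ifs with h
    · rfl
    · exact (twoPoint_eq_zero hx φ (by lia) u v).symm
  have hdvd : ∀ a, ¬ (T : ℤ) ∣ a + r → S a = 0 ∧ s.coeff a = 0 := by
    intro a ha
    have : S a = 0 := by
      rw [hS, twoPoint, M.o_eq_zero_of_eigen hT hu ha, map_zero]
    refine ⟨this, ?_⟩
    rw [hs, this, ite_self]
  let q : ℂ[T;T⁻¹] := p - (LaurentPolynomial.T (T : ℤ) - 1) ^ k * s
  have hq : ∀ a, q.coeff a = ∑ i ∈ Finset.range (k + 1), ((-1 : ℂ) ^ i * (k.choose i : ℂ)) *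
      (S (a - T * ((k : ℤ) - i)) - s.coeff (a - T * ((k : ℤ) - i))) := by
    intro a
    simp only [q, AddMonoidAlgebra.coeff_sub, Finsupp.sub_apply, coeff_sub_one_pow_mul, hp,
      mul_sub, Finset.sum_sub_distrib]
  have hT' : (0 : ℤ) < T := by exact_mod_cast hT
  refine ⟨k, q, fun a ha => ⟨?_, ?_, ?_⟩, ?_⟩
  · by_contra hcon
    refine ha ?_
    have h1 := numerator_vanishesBelow hT hx φ u v hp' a (not_le.1 hcon)
    have h2 : PolyVanishesBelow (-(n : ℤ)) s := fun b hb => by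
      rw [hs, if_neg (by lia)]
    have h3 := h2.sub_one_pow_mul hT'.le k a (not_le.1 hcon)
    rw [AddMonoidAlgebra.coeff_sub, Finsupp.sub_apply, h1, h3, sub_zero]
  · by_contra hcon
    refine ha ?_
    rw [hq]
    refine Finset.sum_eq_zero fun i _ => ?_
    rw [hsS, sub_self, mul_zero]
    have : (0 : ℤ) ≤ T * i := by positivity
    rw [mul_sub]
    lia
  · by_contra hcon
    refine ha ?_
    rw [hq]
    refine Finset.sum_eq_zero fun i _ => ?_
    have := hdvd (a - T * ((k : ℤ) - i)) (fun hd => hcon ?_)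
    · rw [this.1, this.2, sub_self, mul_zero]
    · have h1 := dvd_add hd (dvd_mul_right (T : ℤ) ((k : ℤ) - i))
      rwa [show a - T * ((k : ℤ) - i) + r + T * ((k : ℤ) - i) = a + r by ring] at h1
  · apply mul_left_cancel₀ (expSubOne_pow_ne_zero k)
    rw [← hp', show p = q + (LaurentPolynomial.T (T : ℤ) - 1) ^ k * s by simp [q], map_add, map_mul,
      map_pow, evalExp_T_sub_one hT, mul_add, add_comm, map_sum, evalExp_eq_sum]
    simp only [evalExp_single]
    congr 1
    rw [Finset.mul_sum]
    refine Finset.sum_congr rfl fun a _ => ?_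
    rw [mul_smul_comm, mul_comm, expQuot_mul_pow]

/-- `h1` and `h2` evaluate the kernel on the two parts of `correlator_decomposition`. Only degrees
with `T ∣ a + r` contribute. -/
lemma o_zero_res (hT : 0 < T) (hx : x ∈ M.Omega n) {r : ℕ} {u : V} (hu : u ∈ eigen g T r) (v : V)
    {h : LaurentSeries ℂ} {ε : ℂ}
    (h1 : ∀ a : ℤ, -(n : ℤ) ≤ a → a ≤ n → (T : ℤ) ∣ a + r →
      residue (h * expo ((a : ℂ) / T)) = if a = 0 then ε else 0)
    (h2 : ∀ (a : ℤ) (k : ℕ), -(n : ℤ) ≤ a → a < T * k - n → (T : ℤ) ∣ a + r →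
      residue (h * expQuot ((a : ℂ) / T) k) = 0) :
    M.o 0 (res h u v) x = ε • M.o 0 u (M.o 0 v x) := by
  rw [← sub_eq_zero]
  refine M.eq_zero_of_dual fun φ => ?_
  rw [map_sub, map_smul, sub_eq_zero, apply_o_res]
  obtain ⟨k, q, hq, hc⟩ := correlator_decomposition hT hx φ hu v
  rw [hc, mul_add, Finset.mul_sum, Finset.mul_sum, residue, coeff_add, HahnSeries.coeff_sum,
    HahnSeries.coeff_sum, Finset.sum_eq_single_of_mem (0 : ℤ) (by simp)]
  · rw [Finset.sum_eq_zero fun a ha => ?_, add_zero, mul_smul_comm, HahnSeries.coeff_smul]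
    · by_cases hr : (T : ℤ) ∣ 0 + r
      · have := h1 0 (by simp) (by simp) hr
        rw [residue, if_pos rfl] at this
        rw [this, twoPoint, sub_zero, smul_eq_mul, smul_eq_mul, mul_comm]
      · rw [twoPoint, M.o_eq_zero_of_eigen hT hu hr, M.o_eq_zero_of_eigen hT hu hr]
        simp
    · obtain ⟨ha1, ha2, ha3⟩ := hq a (Finsupp.mem_support_iff.1 ha)
      have := h2 a k ha1 ha2 ha3
      rw [residue] at this
      rw [mul_smul_comm, HahnSeries.coeff_smul, this, smul_zero]
  · intro a ha ha0
    rw [Finset.mem_Icc] at ha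
    rw [mul_smul_comm, HahnSeries.coeff_smul]
    by_cases hr : (T : ℤ) ∣ a + r
    · have := h1 a ha.1 ha.2 hr
      rw [residue, if_neg ha0] at this
      rw [this, smul_zero]
    · rw [twoPoint, M.o_eq_zero_of_eigen hT hu hr, map_zero, zero_smul]

end Omega
end TwistedPhiModule

/-! ### Residues of the kernel of `•` against correlators. -/

section BulletResidues

/-- Each term has integral exponent `l + 1 + m`, at least 1 and less than the pole order `l + i + 1
+ k`. -/
lemma residue_bulletSeries_mul_expQuot {l k : ℕ} {m : ℤ} (h1 : -(l : ℤ) ≤ m) (h2 : m < k - l) :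
    residue (bulletSeries l * expQuot m k) = 0 := by
  rw [bulletSeries, Finset.sum_mul, residue, HahnSeries.coeff_sum]
  refine Finset.sum_eq_zero fun i _ => ?_
  obtain ⟨j, hj⟩ : ∃ j : ℕ, (l : ℤ) + m = j := ⟨((l : ℤ) + m).toNat, by lia⟩
  have hj' : (l : ℂ) + 1 + m = ((j + 1 : ℕ) : ℂ) := by
    have : (l : ℂ) + m = j := by exact_mod_cast hj
    push_cast
    linear_combination this
  rw [smul_mul_assoc, HahnSeries.coeff_smul, expQuot_mul, hj']
  have := residue_expQuot_eq_zero (m := j + 1) (k := l + i + 1 + k) (by lia) (by lia)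
  rw [residue] at this
  rw [this, smul_zero]

lemma residue_bulletSeries_mul_expo {l : ℕ} {m : ℤ} (h1 : -(l : ℤ) ≤ m) (h2 : m ≤ l) :
    residue (bulletSeries l * expo m) = if m = 0 then 1 else 0 := by
  split_ifs with h0
  · rw [h0, Int.cast_zero, expo_zero, mul_one, residue_bulletSeries]
  -- The term with `B'` has residue zero since `1 ≤ l + 1 + m < 2 l + 2`, so `m` times the wanted
  -- residue is zero.
  · have h := coeff_deriv_neg_one (bulletSeries l * expo m)
    obtain ⟨j, hj⟩ : ∃ j : ℕ, (l : ℤ) + m = j := ⟨((l : ℤ) + m).toNat, by lia⟩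
    have hj' : (l : ℂ) + 1 + m = ((j + 1 : ℕ) : ℂ) := by
      have : (l : ℂ) + m = j := by exact_mod_cast hj
      push_cast
      linear_combination this
    have hz := residue_expQuot_eq_zero (m := j + 1) (k := l + (l + 1) + 1) (by lia) (by lia)
    rw [residue] at hz
    rw [deriv_mul, deriv_expo, deriv_bulletSeries, coeff_add, smul_mul_assoc, ← expQuot_zero,
      expQuot_mul, add_zero, hj', HahnSeries.coeff_smul, hz, smul_zero, zero_add, mul_smul_comm,
      HahnSeries.coeff_smul, smul_eq_mul, mul_eq_zero, expQuot_zero] at h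
    exact h.resolve_left (by exact_mod_cast h0)

end BulletResidues

/-! ### The action of `Ã_{g, n}(V)` on `Ω̃_n(W)`. -/

namespace TwistedPhiModule

variable {V : Type u} [AddCommGroup V] [Module ℂ V] [VertexAlgebra V] {g : Aut V} {T : ℕ}
  {M : TwistedPhiModule.{u, w} g T} {n : ℕ} {x : M.carrier}

lemma o_zero_diamond (hT : 0 < T) (hx : x ∈ M.Omega n) {r : ℕ} (hr : r < T) {u : V}
    (hu : u ∈ eigen g T r) (v : V) : M.o 0 (diamond T n r u v) x = 0 := by
  have hT' : (T : ℂ) ≠ 0 := by exact_mod_cast hT.ne'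
  have hn := Nat.div_add_mod n T
  have hnT := Nat.mod_lt n hT
  set K := 2 * (n / T) + stepDelta (n % T) r + stepDelta (n % T) (T - r) + 1 with hK
  -- The `δ` terms are tuned so that this bound and the next keep the total exponent strictly
  -- between 0 and the pole order.
  have hlow : n < T * (n / T + stepDelta (n % T) r) + r := by
    rw [mul_add, stepDelta]
    split_ifs <;> lia
  have hhigh : T * (n / T + stepDelta (n % T) r) + r + n < T * K := by
    have : T * K = T * (n / T + stepDelta (n % T) r) +
        (T * (n / T) + T * stepDelta (n % T) (T - r) + T) := by rw [hK]; ring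
    rw [this]
    have : r + n % T < T * stepDelta (n % T) (T - r) + T := by
      rw [stepDelta]
      split_ifs <;> lia
    lia
  -- The range `a ≤ T k + n` covers both parts of the correlator, with `k = 0` for the pure
  -- exponentials.
  have key : ∀ (a : ℤ) (k : ℕ), -(n : ℤ) ≤ a → a ≤ T * k + n → (T : ℤ) ∣ a + r →
      residue (expQuot ((stepDelta (n % T) r : ℂ) + ((n / T : ℕ) : ℂ) + (r : ℂ) / T) K *
        expQuot ((a : ℂ) / T) k) = 0 := by
    rintro a k ha1 ha2 ⟨m, hm⟩
    have hm' : (a : ℂ) + r = T * m := by exact_mod_cast hm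
    have hpos : (0 : ℤ) < T * ((n / T + stepDelta (n % T) r : ℕ) + m) := by
      rw [mul_add, ← hm]
      have : (n : ℤ) < T * (n / T + stepDelta (n % T) r : ℕ) + r := by exact_mod_cast hlow
      lia
    have hlt : (T : ℤ) * ((n / T + stepDelta (n % T) r : ℕ) + m) < T * (K + k : ℕ) := by
      rw [mul_add, ← hm]
      have : (T : ℤ) * (n / T + stepDelta (n % T) r : ℕ) + r + n < T * K := by
        exact_mod_cast hhigh
      push_cast at this ⊢
      rw [mul_add (T : ℤ) K]
      lia
    have h1 := pos_of_mul_pos_right hpos (by positivity)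
    have h2 := lt_of_mul_lt_mul_left hlt (by positivity)
    obtain ⟨j, hj⟩ : ∃ j : ℕ, ((n / T + stepDelta (n % T) r : ℕ) : ℤ) + m = j :=
      ⟨_, (Int.toNat_of_nonneg h1.le).symm⟩
    have hj' : ((n / T + stepDelta (n % T) r : ℕ) : ℂ) + m = j := by
      have := congrArg (Int.cast : ℤ → ℂ) hj
      push_cast at this ⊢
      exact this
    rw [expQuot_mul]
    have he : (stepDelta (n % T) r : ℂ) + ((n / T : ℕ) : ℂ) + (r : ℂ) / T + (a : ℂ) / T = j := by
      rw [← hj', add_assoc, ← add_div, add_comm (r : ℂ), hm', mul_div_cancel_left₀ _ hT']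
      push_cast
      ring
    rw [he]
    exact residue_expQuot_eq_zero (by lia) (by lia)
  rw [diamond, o_zero_res hT hx hu v (ε := 0), zero_smul]
  · intro a ha1 ha2 ha3
    rw [ite_self, ← expQuot_zero]
    exact key a 0 ha1 (by simpa using ha2) ha3
  · intro a k ha1 ha2 ha3
    exact key a k ha1 (by lia) ha3

lemma o_zero_res_bulletSeries (hT : 0 < T) (hx : x ∈ M.Omega n) {u : V} (hu : u ∈ eigen g T 0)
    (v : V) : M.o 0 (res (bulletSeries (n / T)) u v) x = M.o 0 u (M.o 0 v x) := by
  have hT' : (T : ℂ) ≠ 0 := by exact_mod_cast hT.ne'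
  have hTz : (0 : ℤ) < T := by exact_mod_cast hT
  have hn : (T : ℤ) * (n / T : ℕ) + (n % T : ℕ) = n := by exact_mod_cast Nat.div_add_mod n T
  have hnT : ((n % T : ℕ) : ℤ) < T := by exact_mod_cast Nat.mod_lt n hT
  have hlow : ∀ m : ℤ, -(n : ℤ) ≤ T * m → -((n / T : ℕ) : ℤ) ≤ m := by
    intro m hm
    by_contra hcon
    nlinarith
  rw [o_zero_res hT hx hu v (ε := 1), one_smul]
  · rintro a ha1 ha2 ⟨m, hm⟩
    rw [Nat.cast_zero, add_zero] at hm
    subst hm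
    rw [Int.cast_mul, Int.cast_natCast, mul_div_cancel_left₀ _ hT',
      residue_bulletSeries_mul_expo (hlow m ha1)]
    · simp [hT.ne']
    · by_contra hcon
      nlinarith
  · rintro a k ha1 ha2 ⟨m, hm⟩
    rw [Nat.cast_zero, add_zero] at hm
    subst hm
    rw [Int.cast_mul, Int.cast_natCast, mul_div_cancel_left₀ _ hT']
    refine residue_bulletSeries_mul_expQuot (hlow m ha1) ?_
    by_contra hcon
    have : (0 : ℤ) ≤ (n % T : ℕ) := by positivity
    nlinarith

lemma o_zero_of_mem_zhuO (hT : 0 < T) (hx : x ∈ M.Omega n) {v : V} (hv : v ∈ zhuO g T n) :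
    M.o 0 v x = 0 := by
  have h : zhuO g T n ≤ LinearMap.ker (M.oHom 0 x) := by
    refine Submodule.span_le.2 ?_
    rintro _ (⟨r, hr, u, hu, v, rfl⟩ | ⟨v, rfl⟩)
    · exact o_zero_diamond hT hx hr hu v
    · exact M.o_zero_opD hT v x
  exact h hv

lemma o_zero_bullet (hT : 0 < T) (hg : orderOf g.toLinearEquiv = T) (hx : x ∈ M.Omega n)
    (u v : V) : M.o 0 (bullet g T n u v) x = M.o 0 u (M.o 0 v x) := by
  rw [bullet_eq, o_zero_res_bulletSeries hT hx (projZero_mem hT hg u)]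
  -- The difference between `u` and its projection lies in `Õ`, and so kills `o(v) x`, which is
  -- again in `Ω̃_n`.
  have := o_zero_of_mem_zhuO hT (o_zero_mem_Omega hT hx v) (projZero_sub_mem_zhuO hT hg n u)
  rw [← oHom_apply, map_sub, sub_eq_zero] at this
  exact this.symm

lemma Hom.map_mem_Omega {M N : TwistedPhiModule.{u, w} g T} (f : Hom M N) {n : ℕ}
    {x : M.carrier} (hx : x ∈ M.Omega n) : f.toLinearMap x ∈ N.Omega n := by
  rw [mem_Omega] at hx ⊢
  intro v a ha
  rw [← f.map_o, hx v a ha, map_zero]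

end TwistedPhiModule

/-! ### The quotient algebra and its modules. -/

section ZhuAlgebra

variable {V : Type u} [AddCommGroup V] [Module ℂ V] [VertexAlgebra V] (g : Aut V) (T : ℕ)

lemma toZhu_surjective (n : ℕ) : Function.Surjective (toZhu g T n) :=
  Submodule.mkQ_surjective _

variable {g T}

lemma toZhu_eq_iff {n : ℕ} {u v : V} : toZhu g T n u = toZhu g T n v ↔ u - v ∈ zhuO g T n :=
  Submodule.Quotient.eq _

/-- The product of `Ã_{g, n}(V)`. -/
def zhuMul (hT : 0 < T) (hg : orderOf g.toLinearEquiv = T) (n : ℕ) :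
    (V ⧸ zhuO g T n) →ₗ[ℂ] (V ⧸ zhuO g T n) →ₗ[ℂ] (V ⧸ zhuO g T n) :=
  (zhuO g T n).liftQ
    { toFun := fun u => (zhuO g T n).mapQ (zhuO g T n) (bulletHom g T n u) fun v hv => by
        rw [Submodule.mem_comap, bulletHom_apply]
        exact bullet_mem_right hT hg u hv
      map_add' := fun u u' => by ext v; simp
      map_smul' := fun c u => by ext v; simp }
    fun u hu => by
      rw [LinearMap.mem_ker]
      ext v
      simp only [LinearMap.coe_mk, AddHom.coe_mk, LinearMap.comp_apply, Submodule.mkQ_apply,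
        Submodule.mapQ_apply, LinearMap.zero_apply, bulletHom_apply]
      exact (Submodule.Quotient.mk_eq_zero _).2 (bullet_mem_left hT hg v hu)

lemma zhuMul_mk (hT : 0 < T) (hg : orderOf g.toLinearEquiv = T) (n : ℕ) (u v : V) :
    zhuMul hT hg n ((zhuO g T n).mkQ u) ((zhuO g T n).mkQ v) =
      (zhuO g T n).mkQ (bullet g T n u v) := by
  rw [← bulletHom_apply]
  rfl

/-- The ring `Ã_{g, n}(V)`. -/
abbrev zhuRing (hT : 0 < T) (hg : orderOf g.toLinearEquiv = T) (n : ℕ) : Ring (Zhu g T n) :=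
  { (Submodule.Quotient.addCommGroup (zhuO g T n) : AddCommGroup (Zhu g T n)) with
    mul := fun a b => zhuMul hT hg n a b
    one := toZhu g T n vac
    left_distrib := fun a b c => LinearMap.map_add (zhuMul hT hg n a) b c
    right_distrib := fun a b c => LinearMap.map_add₂ (zhuMul hT hg n) a b c
    zero_mul := fun a => LinearMap.map_zero₂ (zhuMul hT hg n) a
    mul_zero := fun a => map_zero (zhuMul hT hg n a)
    mul_assoc := fun a b c => by
      obtain ⟨u, rfl⟩ := toZhu_surjective g T n a
      obtain ⟨v, rfl⟩ := toZhu_surjective g T n b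
      obtain ⟨w, rfl⟩ := toZhu_surjective g T n c
      change zhuMul hT hg n (zhuMul hT hg n ((zhuO g T n).mkQ u) ((zhuO g T n).mkQ v))
        ((zhuO g T n).mkQ w) = zhuMul hT hg n ((zhuO g T n).mkQ u)
          (zhuMul hT hg n ((zhuO g T n).mkQ v) ((zhuO g T n).mkQ w))
      simp only [zhuMul_mk]
      exact toZhu_eq_iff.2 (bullet_assoc_mem hT hg n u v w)
    one_mul := fun a => by
      obtain ⟨u, rfl⟩ := toZhu_surjective g T n a
      exact (zhuMul_mk hT hg n vac u).trans (congrArg _ (vac_bullet hT n u))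
    mul_one := fun a => by
      obtain ⟨u, rfl⟩ := toZhu_surjective g T n a
      exact (zhuMul_mk hT hg n u vac).trans (toZhu_eq_iff.2 (bullet_vac_mem hT hg n u)) }

/-- The `ℂ`-algebra `Ã_{g, n}(V)`. -/
abbrev zhuAlgebra (hT : 0 < T) (hg : orderOf g.toLinearEquiv = T) (n : ℕ) :
    letI := zhuRing hT hg n
    Algebra ℂ (Zhu g T n) :=
  letI := zhuRing hT hg n
  letI : Module ℂ (Zhu g T n) := Submodule.Quotient.module (zhuO g T n)
  Algebra.ofModule
    (fun c a b => LinearMap.map_smul₂ (zhuMul hT hg n) c a b)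
    (fun c a b => map_smul (zhuMul hT hg n a) c b)

namespace TwistedPhiModule

/-- The operator `o(v)` on `Ω̃_n(W)`. -/
def oOmega (hT : 0 < T) (M : TwistedPhiModule.{u, w} g T) (n : ℕ) :
    V →ₗ[ℂ] Module.End ℂ (M.Omega n) where
  toFun v := (M.o 0 v).restrict fun _ hx => o_zero_mem_Omega hT hx v
  map_add' u v := by
    ext x
    exact congrArg (fun f : Module.End ℂ M.carrier => f x) (M.o_add 0 u v)
  map_smul' c v := by
    ext x
    exact congrArg (fun f : Module.End ℂ M.carrier => f x) (M.o_smul 0 c v)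

/-- The action of `Ã_{g, n}(V)` on `Ω̃_n(W)`. -/
def zhuAction (hT : 0 < T) (hg : orderOf g.toLinearEquiv = T) (M : TwistedPhiModule.{u, w} g T)
    (n : ℕ) :
    letI := zhuRing hT hg n
    Zhu g T n →+* Module.End ℂ (M.Omega n) :=
  letI := zhuRing hT hg n
  let L : (V ⧸ zhuO g T n) →ₗ[ℂ] Module.End ℂ (M.Omega n) :=
    (zhuO g T n).liftQ (M.oOmega hT n) fun v hv => by
      rw [LinearMap.mem_ker]
      ext x
      exact o_zero_of_mem_zhuO hT x.2 hv
  { toFun := L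
    map_zero' := map_zero L
    map_add' := map_add L
    map_one' := by
      ext x
      exact (M.o_vac 0 x).trans (if_pos rfl)
    map_mul' := fun a b => by
      obtain ⟨u, rfl⟩ := toZhu_surjective g T n a
      obtain ⟨v, rfl⟩ := toZhu_surjective g T n b
      have h := zhuMul_mk hT hg n u v
      ext x
      change ((L (zhuMul hT hg n ((zhuO g T n).mkQ u) ((zhuO g T n).mkQ v)) x : M.Omega n) :
        M.carrier) = _
      rw [h]
      exact o_zero_bullet hT hg x.2 u v }

lemma zhuAction_toZhu (hT : 0 < T) (hg : orderOf g.toLinearEquiv = T)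
    (M : TwistedPhiModule.{u, w} g T) (n : ℕ) (v : V) (x : M.Omega n) :
    (M.zhuAction hT hg n (toZhu g T n v) x : M.carrier) = M.o 0 v x := rfl

end TwistedPhiModule

end ZhuAlgebra
end VertexAlgebra
end

open VertexAlgebra in
/-- Below, the natural number `n` stands for the element `n / T` of `(1/T) ℕ`. -/
theorem theorem4p4 {V : Type u} [AddCommGroup V] [Module ℂ V] [VertexAlgebra V]
    (g : Aut V) (T : ℕ) (hT : 0 < T) (hg : orderOf g.toLinearEquiv = T) (n : ℕ) :
    ∃ (_ : Ring (Zhu g T n)) (_ : Algebra ℂ (Zhu g T n)),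
      ((∀ u v : V, toZhu g T n (u + v) = toZhu g T n u + toZhu g T n v) ∧
        (∀ (c : ℂ) (v : V), toZhu g T n (c • v) = c • toZhu g T n v) ∧
        (∀ u v : V, toZhu g T n (bullet g T n u v) = toZhu g T n u * toZhu g T n v) ∧
        toZhu g T n vac = 1) ∧
      ∃ _ : ∀ M : TwistedPhiModule.{u, w} g T, Module (Zhu g T n) (M.Omega n),
        (∀ (M : TwistedPhiModule.{u, w} g T) (v : V) (x : M.Omega n),
          ((toZhu g T n v • x : M.Omega n) : M.carrier) = M.o 0 v x) ∧
        ∃ F : ∀ {M N : TwistedPhiModule.{u, w} g T}, TwistedPhiModule.Hom M N →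
            (M.Omega n →ₗ[Zhu g T n] N.Omega n),
          (∀ {M N : TwistedPhiModule.{u, w} g T} (f : TwistedPhiModule.Hom M N) (x : M.Omega n),
            ((F f x : N.Omega n) : N.carrier) = f.toLinearMap x) ∧
          (∀ M : TwistedPhiModule.{u, w} g T,
            F (TwistedPhiModule.Hom.id M) = LinearMap.id) ∧
          (∀ {M N P : TwistedPhiModule.{u, w} g T} (f' : TwistedPhiModule.Hom N P)
            (f : TwistedPhiModule.Hom M N), F (f'.comp f) = (F f').comp (F f)) := by
  let _ := zhuRing hT hg n
  let _ (M : TwistedPhiModule.{u, w} g T) : Module (Zhu g T n) (M.Omega n) :=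
    Module.compHom (M.Omega n) (M.zhuAction hT hg n)
  refine ⟨zhuRing hT hg n, zhuAlgebra hT hg n, ⟨fun _ _ => rfl, fun _ _ => rfl,
    fun u v => (zhuMul_mk hT hg n u v).symm, rfl⟩,
    fun M => Module.compHom (M.Omega n) (M.zhuAction hT hg n),
    fun M v x => M.zhuAction_toZhu hT hg n v x,
    fun {M N} f =>
      { toFun := fun x => ⟨f.toLinearMap x, f.map_mem_Omega x.2⟩
        map_add' := fun x y => Subtype.ext (map_add f.toLinearMap (x : M.carrier) y)
        map_smul' := fun a x => by
          -- Every scalar is the class of some `v`, so linearity reduces to commuting with `o(v)`.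
          obtain ⟨v, rfl⟩ := toZhu_surjective g T n a
          exact Subtype.ext (f.map_o 0 v x) },
    fun _ _ => rfl, fun _ => rfl, fun _ _ => rfl⟩
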